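/- **Setting.** Let $\mathcal M=(N,\mathcal I)$ be a matroid of rank $k\ge 1$ on a finite set $N$ with $n$ elements, and let $f:2^N\to\mathbb R$ be non-negative and submodular (not necessarily monotone), given by a value oracle that returns $f(S)$ when $S\subseteq N$ is queried. Write $f(u\mid S)=f(S\cup\{u\})-f(S)$, $S+u=S\cup\{u\}$ and $S-u=S\setminus\{u\}$. Add a set $D$ of $2k$ dummy elements: $N'=N\cup D$, $f'(S)=f(S\setminus D)$, and $S\in\mathcal I'$ if and only if $S\setminus D\in\mathcal I$ and $|S|\le k$. In the algorithm below "base" means an inclusion-wise maximal member of $\mathcal I'$, and $f$ stands for $f'$. A distribution $\mathcal D$ over subsets of $N'$ is represented explicitly by a finite multiset of pairs $(p,S)$, and $\operatorname{supp}(\mathcal D)$ is the set of the distinct $S$ that occur. **Algorithm (derandomized Random Greedy).** Let $\mathcal D_0=\{(1,S_0)\}$, where $S_0$ is an arbitrary base contained in $D$. For $i=1,\dots,k$: 1. Let $M_i$ be a base maximizing $\sum_{u\in M_i}\mathbb E_{S\sim\mathcal D_{i-1}}[f(u\mid S)]$. 2. For every $S\in\operatorname{supp}(\mathcal D_{i-1})$,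 let $\bar S\supseteq S$ be a base obtained from $S$ by adding dummy elements (so $\bar S=S$ if $S$ is a base), and let $g_{i,S}:M_i\to\bar S$ be a one-to-one mapping with $g_{i,S}(u)=u$ for $u\in M_i\cap\bar S$ and $\bar S+u-g_{i,S}(u)\in\mathcal I'$ for all $u\in M_i$. 3. Let $x$ be an extreme point of the polyhedron of all $(x(u,S))_{u\in M_i,\,S\in\operatorname{supp}(\mathcal D_{i-1})}$ with (all $\mathbb E$ and $\Pr$ over $S\sim\mathcal D_{i-1}$) $$\sum_{u\in M_i}\mathbb E[x(u,S)f(u\mid S)]\ \ge\ \tfrac1k\sum_{u\in M_i}\mathbb E[f(u\mid S)],$$ $$\sum_{u\in M_i}\mathbb E[x(u,S)f(g_{i,S}(u)\mid S-g_{i,S}(u))]\ \le\ \tfrac1k\sum_{u\in M_i}\mathbb E[f(g_{i,S}(u)\mid S-g_{i,S}(u))],$$ $$\mathbb E[x(u,S)\mathbf 1[u\notin S]]\le\tfrac1k\Pr[u\notin S]\quad(u\in M_i),\qquad \mathbb E[x(g_{i,S}^{-1}(u),S)\mathbf 1[u\in S]]\ge\tfrac1k\Pr[u\in S]\quad(u\in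 N'),$$ $$\sum_{u\in M_i}x(u,S)=1\quad(S\in\operatorname{supp}(\mathcal D_{i-1})),\qquad x(u,S)\ge 0\quad(u\in M_i,\ S\in\operatorname{supp}(\mathcal D_{i-1})).$$ 4. Let $\mathcal D_i=\{(x(u,S)\Pr_{\mathcal D_{i-1}}[S],\ (S\cup\{u\})\setminus\{g_{i,S}(u)\})\mid u\in M_i,\ S\in\operatorname{supp}(\mathcal D_{i-1}),\ x(u,S)>0\}$. Finally, return $S\setminus D$ for some $S\in\operatorname{supp}(\mathcal D_k)$ maximizing $f(S)$. In each iteration the algorithm queries the values of $S$, $S+u$ and $S-u$ for all $S\in\operatorname{supp}(\mathcal D_{i-1})$ and $u\in N'$; at the end it queries the values of all $S\in\operatorname{supp}(\mathcal D_k)$. All choices are made by an arbitrary deterministic rule, which in each iteration depends only on $i$, on $\mathcal D_{i-1}$ and on the values queried in that iteration (and, at the end, on $\mathcal D_k$ and the values queried there). **Theorem.** There is an absolute constant $C>0$ such that, for every such $\mathcal M$ and $f$ and every such rule, the algorithm is a well-defined deterministic algorithm (all the objects it has to choose exist, in particular every linear program has an extreme point), it returns a set $S^*\in\mathcal I$ with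 $$f(S^*)\ \ge\ \Bigl(\frac{1+e^{-2}}4-\frac C{k^2}\Bigr)\max_{O\in\mathcal I}f(O),$$ and it makes at most $C\,n^2k^2$ value-oracle queries. -/

import Mathlib

/-! ### Deterministic algorithms with access to a value oracle -/

/-- A deterministic algorithm with access to a value oracle for an unknown set function
`f : Finset α → ℝ`: it either stops with a result, or queries a set `S` and continues in a way that
is determined by the answer `f S`. -/
inductive QueryAlg (α : Type*) (β : Type*) where
  | ret (b : β) : QueryAlg α β
  | query (S : Finset α) (next : ℝ → QueryAlg α β) : QueryAlg α β

namespace QueryAlg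

variable {α β γ : Type*}

/-- The result of the algorithm when the oracle answers according to `f`. -/
def eval (f : Finset α → ℝ) : QueryAlg α β → β
  | ret b => b
  | query S next => (next (f S)).eval f

/-- The number of oracle queries made when the oracle answers according to `f`. -/
def numQueries (f : Finset α → ℝ) : QueryAlg α β → ℕ
  | ret _ => 0
  | query S next => (next (f S)).numQueries f + 1

/-- Sequential composition. -/
def bind : QueryAlg α β → (β → QueryAlg α γ) → QueryAlg α γ
  | ret b, c => c b
  | query S next, c => query S fun v => (next v).bind c

end QueryAlg

/-! ### Submodular functions -/

def IsSubmodular {α : Type*} [DecidableEq α] (f : Finset α → ℝ) : Prop :=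
  ∀ S T : Finset α, f (S ∪ T) + f (S ∩ T) ≤ f S + f T

/-- The marginal value `h(u ∣ S) = h(S + u) - h(S)`. -/
def marginal {β : Type*} [DecidableEq β] (h : Finset β → ℝ) (u : β) (S : Finset β) : ℝ :=
  h (insert u S) - h S

/-! ### Explicit distributions over sets -/

/-- A distribution over sets, represented by a multiset of pairs `(p, S)`. -/
abbrev SetDist (β : Type*) := Multiset (ℝ × Finset β)

namespace SetDist

variable {β : Type*} [DecidableEq β]

/-- The distinct sets occurring in the distribution. -/
def supp (D : SetDist β) : Finset (Finset β) := (D.map Prod.snd).toFinset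

/-- The expectation of `φ(S)` for `S ∼ D`. -/
def expect (D : SetDist β) (φ : Finset β → ℝ) : ℝ := (D.map fun q => q.1 * φ q.2).sum

/-- The probability of the event `P(S)` for `S ∼ D`. -/
def prob (D : SetDist β) (P : Finset β → Prop) [DecidablePred P] : ℝ :=
  D.expect fun S => if P S then 1 else 0

end SetDist

/-! ### The instance with dummy elements -/

/-- The ground set `N' = N ∪ D`, where `D` consists of `2k` dummy elements. For a set
`S : Finset (DExt α k)`, the set `S ∖ D` is `S.toLeft : Finset α`. -/
abbrev DExt (α : Type*) (k : ℕ) := α ⊕ Fin (2 * k)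

/-- `S` is independent in the extended matroid: `S ∖ D` is independent in `M` and `|S| ≤ k`. -/
def ExtIndep {α : Type*} (M : Matroid α) (k : ℕ) (S : Finset (DExt α k)) : Prop :=
  M.Indep (S.toLeft : Set α) ∧ S.card ≤ k

/-- Bases of the extended matroid. -/
def IsExtBase {α : Type*} (M : Matroid α) (k : ℕ) (S : Finset (DExt α k)) : Prop :=
  Maximal (ExtIndep M k) S

namespace DerandomizedGreedy

variable {α : Type*} [Fintype α] [DecidableEq α] {k : ℕ}

/-- `S` is a base containing only dummy elements. -/
def IsInitialSet (M : Matroid α) (k : ℕ) (S : Finset (DExt α k)) : Prop :=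
  IsExtBase M k S ∧ S.toLeft = ∅

/-- `B` is a base maximizing `∑ u ∈ B, E_{S ∼ D} [h(u ∣ S)]`. -/
def IsMaxBase (M : Matroid α) (h : Finset (DExt α k) → ℝ) (D : SetDist (DExt α k))
    (B : Finset (DExt α k)) : Prop :=
  IsExtBase M k B ∧ ∀ B', IsExtBase M k B' →
    ∑ u ∈ B', D.expect (fun S => marginal h u S) ≤ ∑ u ∈ B, D.expect (fun S => marginal h u S)

/-- `g` is an exchange mapping from the base `B` to the set `S`. A set `S` with fewer than `k`
elements is first completed by dummy elements to a base `T`; if `S` is a base then `T = S`.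
The mapping `g : B → T` is one-to-one, is the identity on `B ∩ T`, and `T + u - g(u)` is independent
for all `u ∈ B`. -/
def IsExchange (M : Matroid α) (B S : Finset (DExt α k)) (g : DExt α k → DExt α k) : Prop :=
  ∃ T, IsExtBase M k T ∧ S ⊆ T ∧ T.toLeft = S.toLeft ∧
    Set.MapsTo g B T ∧ Set.InjOn g B ∧ (∀ u ∈ B ∩ T, g u = u) ∧
    ∀ u ∈ B, ExtIndep M k ((insert u T).erase (g u))

/-- The feasible region of the linear program. The variables are `x u S` for `u ∈ B` and
`S ∈ supp D`; the other coordinates are fixed to be `0`. In `kick`, for `u ∈ S` there is exactly one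
`v ∈ B` with `g S v = u`, so that the inner sum is `x (g_S⁻¹ u) S`. -/
structure IsFeasible (h : Finset (DExt α k) → ℝ) (D : SetDist (DExt α k)) (B : Finset (DExt α k))
    (g : Finset (DExt α k) → DExt α k → DExt α k) (x : DExt α k → Finset (DExt α k) → ℝ) : Prop where
  gain : 1 / (k : ℝ) * ∑ u ∈ B, D.expect (fun S => marginal h u S) ≤
    ∑ u ∈ B, D.expect (fun S => x u S * marginal h u S)
  loss : ∑ u ∈ B, D.expect (fun S => x u S * marginal h (g S u) (S.erase (g S u))) ≤
    1 / (k : ℝ) * ∑ u ∈ B, D.expect (fun S => marginal h (g S u) (S.erase (g S u)))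
  add : ∀ u ∈ B, D.expect (fun S => x u S * if u ∉ S then 1 else 0) ≤
    1 / (k : ℝ) * D.prob (fun S => u ∉ S)
  kick : ∀ u : DExt α k, 1 / (k : ℝ) * D.prob (fun S => u ∈ S) ≤
    D.expect (fun S => (∑ v ∈ B with g S v = u, x v S) * if u ∈ S then 1 else 0)
  sum_eq_one : ∀ S ∈ D.supp, ∑ u ∈ B, x u S = 1
  nonneg : ∀ u ∈ B, ∀ S ∈ D.supp, 0 ≤ x u S
  eq_zero : ∀ u S, ¬ (u ∈ B ∧ S ∈ D.supp) → x u S = 0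

/-- `x` is an extreme point solution of the linear program. -/
def IsExtremeSolution (h : Finset (DExt α k) → ℝ) (D : SetDist (DExt α k)) (B : Finset (DExt α k))
    (g : Finset (DExt α k) → DExt α k → DExt α k) (x : DExt α k → Finset (DExt α k) → ℝ) : Prop :=
  x ∈ Set.extremePoints ℝ {y | IsFeasible h D B g y}

/-- `S` maximizes `h` over the support of `D`. -/
def IsBest (h : Finset (DExt α k) → ℝ) (D : SetDist (DExt α k)) (S : Finset (DExt α k)) : Prop :=
  S ∈ D.supp ∧ ∀ T ∈ D.supp, h T ≤ h S

/-- The distribution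
`{(x(u,S) · Pr_D[S], S + u - g_S(u)) ∣ u ∈ B, S ∈ supp D, x(u,S) > 0}`. -/
noncomputable def newDist (D : SetDist (DExt α k)) (B : Finset (DExt α k))
    (g : Finset (DExt α k) → DExt α k → DExt α k) (x : DExt α k → Finset (DExt α k) → ℝ) :
    SetDist (DExt α k) :=
  ((B ×ˢ D.supp).filter fun q => 0 < x q.1 q.2).val.map fun q =>
    (x q.1 q.2 * D.prob (fun S => S = q.2), (insert q.1 q.2).erase (g q.2 q.1))

/-- A rule by which the algorithm makes its choices. In iteration `i` (counted from `0`) the choices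
depend on `i`, on the current distribution and on the values queried in this iteration. -/
structure Choices (α : Type*) (k : ℕ) where
  /-- the initial set -/
  init : Finset (DExt α k)
  /-- the base chosen in an iteration -/
  base : ℕ → SetDist (DExt α k) → (Finset (DExt α k) → ℝ) → Finset (DExt α k)
  /-- the exchange mappings, for every set of the support -/
  exch : ℕ → SetDist (DExt α k) → (Finset (DExt α k) → ℝ) → Finset (DExt α k) → DExt α k → DExt α k
  /-- the solution of the linear program -/
  point : ℕ → SetDist (DExt α k) → (Finset (DExt α k) → ℝ) → DExt α k → Finset (DExt α k) → ℝ
  /-- the set that is returned -/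
  best : SetDist (DExt α k) → (Finset (DExt α k) → ℝ) → Finset (DExt α k)

namespace Choices

/-- The choices made in one iteration are the ones that the algorithm asks for. -/
def StepCorrect (r : Choices α k) (M : Matroid α) (i : ℕ) (D : SetDist (DExt α k))
    (t : Finset (DExt α k) → ℝ) : Prop :=
  IsMaxBase M t D (r.base i D t) ∧
  (∀ S ∈ D.supp, IsExchange M (r.base i D t) S (r.exch i D t S)) ∧
  IsExtremeSolution t D (r.base i D t) (r.exch i D t) (r.point i D t)

/-- The rule always makes a choice of the kind that the algorithm asks for, provided that there is
one. Nothing is required where there is none. -/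
structure Valid (r : Choices α k) (M : Matroid α) : Prop where
  init : (∃ S, IsInitialSet M k S) → IsInitialSet M k r.init
  base : ∀ i D t, (∃ B, IsMaxBase M t D B) → IsMaxBase M t D (r.base i D t)
  exch : ∀ i D t, ∀ S ∈ D.supp, (∃ g, IsExchange M (r.base i D t) S g) →
    IsExchange M (r.base i D t) S (r.exch i D t S)
  point : ∀ i D t, (∃ x, IsExtremeSolution t D (r.base i D t) (r.exch i D t) x) →
    IsExtremeSolution t D (r.base i D t) (r.exch i D t) (r.point i D t)
  best : ∀ D t, (∃ S, IsBest t D S) → IsBest t D (r.best D t)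

end Choices

/-- Query the values `f'(T) = f(T ∖ D)` of all sets `T` in a list, and collect them in a table, which
is `0` at the sets that are not in the list. -/
def queryTable : List (Finset (DExt α k)) → QueryAlg α (Finset (DExt α k) → ℝ)
  | [] => .ret fun _ => 0
  | T :: L => .query T.toLeft fun v => (queryTable L).bind fun t => .ret (Function.update t T v)

/-- The sets whose values are queried in an iteration: `S`, `S + u` and `S - u` for all
`S ∈ supp D` and `u ∈ N'`. -/
def querySets (D : SetDist (DExt α k)) : Finset (Finset (DExt α k)) :=
  D.supp.biUnion fun S =>
    {S} ∪ Finset.univ.image (fun u => insert u S) ∪ Finset.univ.image (fun u => S.erase u)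

/-- The queries of one iteration, collected in a table. -/
noncomputable def stepQueries (D : SetDist (DExt α k)) : QueryAlg α (Finset (DExt α k) → ℝ) :=
  queryTable (querySets D).toList

/-- The final queries: the values of all the sets in the support. -/
noncomputable def finalQueries (D : SetDist (DExt α k)) : QueryAlg α (Finset (DExt α k) → ℝ) :=
  queryTable D.supp.toList

/-- The first `i` iterations; the result is the distribution `D_i`. -/
noncomputable def iterations (r : Choices α k) : ℕ → QueryAlg α (SetDist (DExt α k))
  | 0 => .ret {(1, r.init)}
  | i + 1 => (iterations r i).bind fun D => (stepQueries D).bind fun t =>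
      .ret (newDist D (r.base i D t) (r.exch i D t) (r.point i D t))

/-- The derandomization of Random Greedy for a matroid of rank `k`, with choices made by `r`: perform
`k` iterations and return the best set of the support, without its dummy elements. -/
noncomputable def algorithm (r : Choices α k) : QueryAlg α (Finset α) :=
  (iterations r k).bind fun D => (finalQueries D).bind fun t => .ret (r.best D t).toLeft

/-- On the input `(M, f)` the algorithm never gets stuck: each of the choices it makes is of the kind
asked for (so that, in particular, every linear program has an extreme point solution). -/
def RunCorrect (r : Choices α k) (M : Matroid α) (f : Finset α → ℝ) : Prop :=
  IsInitialSet M k r.init ∧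
  (∀ i < k, r.StepCorrect M i ((iterations r i).eval f)
    ((stepQueries ((iterations r i).eval f)).eval f)) ∧
  IsBest ((finalQueries ((iterations r k).eval f)).eval f) ((iterations r k).eval f)
    (r.best ((iterations r k).eval f) ((finalQueries ((iterations r k).eval f)).eval f))

end DerandomizedGreedy

/-! Random Greedy would exchange a uniformly random `u` of the chosen base. Its analysis uses only a
few averaged inequalities, and these are the constraints imposed on `x`. Hence the uniform point is
feasible, and every feasible point carries the same guarantee. An extreme point is moreover sparse:
it has at most as many positive coordinates as there are constraints other than non-negativity
(`IsExtremeSolution.card_pos_le`). So the support grows by an additive `O(n)` per iteration instead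
of by a factor `k`; with `k` iterations and `O(n)` queries per set this gives `O(n²k²)`.

For the value, `add` and `kick` force the probability that a given non-dummy element lies in `S` to
be at most `p_i = (1 - (1 - 2/k)^i) / 2` after `i` iterations. Submodularity and non-negativity then
give `E f(O ∪ S) ≥ (1 - p_i) f(O)` (`IsSubmodular.le_expect_inter`). By `gain` and `loss`, adding an
element contributes at least `(E f(O ∪ S) - E f(S)) / k` on average, and removing one costs at most
`E f(S) / k` (`le_expect_newDist`). Solving the resulting recurrence gives `(1 + (1 - 2/k)^(k-1) (1
+ 2/k)) / 4`, which is at least `(1 + e⁻²) / 4 - O(1/k²)`; the best set of the support is at least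
as good as the average.

The choices exist because the extended independence system has the augmentation property: exchange
mappings come from Hall's theorem (`exists_exchange_injOn`), and extreme points from compactness of
the feasible region. -/

namespace QueryAlg

/-! ### Composition of query algorithms -/

variable {α β γ : Type*}

@[simp]
theorem eval_bind (f : Finset α → ℝ) (a : QueryAlg α β) (c : β → QueryAlg α γ) :
    (a.bind c).eval f = (c (a.eval f)).eval f := by
  induction a with
  | ret b => rfl
  | query S next ih => exact ih (f S)

@[simp]
theorem numQueries_bind (f : Finset α → ℝ) (a : QueryAlg α β) (c : β → QueryAlg α γ) :
    (a.bind c).numQueries f = a.numQueries f + (c (a.eval f)).numQueries f := by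
  induction a with
  | ret b => simp [bind, eval, numQueries]
  | query S next ih =>
    simp only [bind, eval, numQueries, ih (f S)]
    ring

@[simp]
theorem eval_ret (f : Finset α → ℝ) (b : β) : (ret b : QueryAlg α β).eval f = b := rfl

@[simp]
theorem numQueries_ret (f : Finset α → ℝ) (b : β) :
    (ret b : QueryAlg α β).numQueries f = 0 := rfl

end QueryAlg

/-! ### Expectations under explicit distributions -/

namespace SetDist

variable {β : Type*}

theorem expect_add (D : SetDist β) (φ ψ : Finset β → ℝ) :
    D.expect (fun S => φ S + ψ S) = D.expect φ + D.expect ψ := by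
  simp [expect, mul_add, Multiset.sum_map_add]

theorem expect_sub (D : SetDist β) (φ ψ : Finset β → ℝ) :
    D.expect (fun S => φ S - ψ S) = D.expect φ - D.expect ψ := by
  simp [expect, mul_sub, Multiset.sum_map_sub]

theorem expect_const_mul (D : SetDist β) (c : ℝ) (φ : Finset β → ℝ) :
    D.expect (fun S => c * φ S) = c * D.expect φ := by
  simp [expect, mul_left_comm _ c, Multiset.sum_map_mul_left]

/-- All the weights are non-negative, and they add up to `1`. -/
structure IsProb (D : SetDist β) : Prop where
  nonneg : ∀ q ∈ D, 0 ≤ q.1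
  expect_one : D.expect (fun _ => 1) = 1

theorem isProb_singleton (S : Finset β) : IsProb ({(1, S)} : SetDist β) :=
  ⟨by simp, by simp [expect]⟩

theorem expect_finset_sum (D : SetDist β) {ι : Type*} (s : Finset ι) (φ : ι → Finset β → ℝ) :
    D.expect (fun S => ∑ i ∈ s, φ i S) = ∑ i ∈ s, D.expect (φ i) := by
  classical
  induction s using Finset.induction_on with
  | empty => simp [expect]
  | insert a s ha ih => simp [Finset.sum_insert ha, expect_add, ih]

theorem IsProb.expect_const {D : SetDist β} (hD : D.IsProb) (c : ℝ) :
    D.expect (fun _ => c) = c := by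
  have := D.expect_const_mul c fun _ => 1
  simpa [hD.expect_one] using this

variable [DecidableEq β]

theorem mem_supp {D : SetDist β} {S : Finset β} : S ∈ D.supp ↔ ∃ q ∈ D, q.2 = S := by
  simp [supp]

theorem expect_congr {D : SetDist β} {φ ψ : Finset β → ℝ} (h : ∀ S ∈ D.supp, φ S = ψ S) :
    D.expect φ = D.expect ψ := by
  unfold expect
  exact congrArg _ (Multiset.map_congr rfl fun q hq => by rw [h _ (mem_supp.2 ⟨q, hq, rfl⟩)])

/-- Groups the pairs that carry the same set. `newDist` is built from these grouped weights. -/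
theorem expect_eq_sum_supp (D : SetDist β) (φ : Finset β → ℝ) :
    D.expect φ = ∑ S ∈ D.supp, D.prob (fun T => T = S) * φ S := by
  calc D.expect φ = D.expect (fun T => ∑ S ∈ D.supp, φ S * if T = S then 1 else 0) :=
        expect_congr fun T hT => by simp [hT]
    _ = _ := by
      rw [expect_finset_sum]
      exact Finset.sum_congr rfl fun S _ => by rw [expect_const_mul, mul_comm, prob]

theorem expect_nonneg {D : SetDist β} (hD : ∀ q ∈ D, 0 ≤ q.1) {φ : Finset β → ℝ}
    (h : ∀ S ∈ D.supp, 0 ≤ φ S) : 0 ≤ D.expect φ := by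
  refine Multiset.sum_nonneg fun a ha => ?_
  obtain ⟨q, hq, rfl⟩ := Multiset.mem_map.1 ha
  exact mul_nonneg (hD q hq) (h _ (mem_supp.2 ⟨q, hq, rfl⟩))

theorem expect_mono {D : SetDist β} (hD : ∀ q ∈ D, 0 ≤ q.1) {φ ψ : Finset β → ℝ}
    (h : ∀ S ∈ D.supp, φ S ≤ ψ S) : D.expect φ ≤ D.expect ψ := by
  rw [← sub_nonneg, ← expect_sub]
  exact expect_nonneg hD fun S hS => sub_nonneg.2 (h S hS)

theorem prob_nonneg {D : SetDist β} (hD : ∀ q ∈ D, 0 ≤ q.1) (P : Finset β → Prop)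
    [DecidablePred P] : 0 ≤ D.prob P :=
  expect_nonneg hD fun S _ => by positivity

theorem IsProb.prob_not {D : SetDist β} (hD : D.IsProb) (P : Finset β → Prop)
    [DecidablePred P] : D.prob (fun S => ¬ P S) = 1 - D.prob P := by
  calc D.prob (fun S => ¬ P S) = D.expect (fun S => 1 - if P S then 1 else 0) :=
        expect_congr fun S _ => by by_cases h : P S <;> simp [h]
    _ = _ := by rw [expect_sub, hD.expect_one, prob]

theorem IsProb.prob_le_one {D : SetDist β} (hD : D.IsProb) (P : Finset β → Prop)
    [DecidablePred P] : D.prob P ≤ 1 := by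
  have := prob_nonneg hD.nonneg fun S => ¬ P S
  rw [hD.prob_not] at this
  linarith

theorem IsProb.supp_nonempty {D : SetDist β} (hD : D.IsProb) : D.supp.Nonempty := by
  by_contra h
  have h0 := D.expect_eq_sum_supp fun _ => 1
  rw [Finset.not_nonempty_iff_eq_empty.1 h, hD.expect_one] at h0
  simp at h0

theorem card_supp_le (D : SetDist β) : D.supp.card ≤ Multiset.card D := by
  simpa [supp] using Multiset.toFinset_card_le (D.map Prod.snd)

end SetDist

/-! ### Inequalities for submodular functions -/

section Submodular

variable {β : Type*} [DecidableEq β] {f : Finset β → ℝ}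

theorem IsSubmodular.marginal_anti (hf : IsSubmodular f) {S T : Finset β} (hST : S ⊆ T) {u : β}
    (hu : u ∉ T) : marginal f u T ≤ marginal f u S := by
  have h := hf T (insert u S)
  have h1 : T ∪ insert u S = insert u T := by
    rw [Finset.union_insert, Finset.union_eq_left.2 hST]
  have h2 : T ∩ insert u S = S := by
    rw [Finset.inter_insert_of_notMem hu, Finset.inter_eq_right.2 hST]
  rw [h1, h2] at h
  unfold marginal
  linarith

theorem marginal_of_mem {u : β} {S : Finset β} (hu : u ∈ S) : marginal f u S = 0 := by
  simp [marginal, hu]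

theorem IsSubmodular.union_right (hf : IsSubmodular f) (O : Finset β) :
    IsSubmodular fun S => f (O ∪ S) := by
  intro S T
  have h := hf (O ∪ S) (O ∪ T)
  rwa [← Finset.union_union_distrib_left, ← Finset.union_inter_distrib_left] at h

theorem IsSubmodular.sub_le_sum_marginal (hf : IsSubmodular f) (O S : Finset β) :
    f (O ∪ S) - f S ≤ ∑ u ∈ O, marginal f u S := by
  induction O using Finset.induction_on with
  | empty => simp
  | insert a O ha ih =>
    rw [Finset.sum_insert ha, Finset.insert_union]
    by_cases haS : a ∈ S
    · rw [Finset.insert_eq_of_mem (Finset.mem_union_right _ haS), marginal_of_mem haS]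
      linarith
    · have := hf.marginal_anti (u := a) (Finset.subset_union_right (s₁ := O) (s₂ := S))
        (by simp [ha, haS])
      unfold marginal at this ih ⊢
      linarith

theorem IsSubmodular.sum_marginal_erase_le (hf : IsSubmodular f) (S : Finset β) :
    ∑ v ∈ S, marginal f v (S.erase v) ≤ f S - f ∅ := by
  -- Only the index set shrinks in the induction; the marginals stay taken at `S - v`, which
  -- contains the part of `R` already added.
  suffices h : ∀ R ⊆ S, ∑ v ∈ R, marginal f v (S.erase v) ≤ f R - f ∅ from h S subset_rfl
  intro R
  induction R using Finset.induction_on with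
  | empty => simp
  | insert a R ha ih =>
    intro hR
    have h1 := ih ((Finset.subset_insert _ _).trans hR)
    have h2 := hf.marginal_anti (u := a) (S := R) (T := S.erase a)
      (fun x hx => Finset.mem_erase.2 ⟨fun h => ha (h ▸ hx), hR (Finset.mem_insert_of_mem hx)⟩)
      (Finset.notMem_erase _ _)
    rw [Finset.sum_insert ha]
    unfold marginal at h2 ⊢
    unfold marginal at h1
    linarith

/-- Exchanging `v` for `u` gains at least `f(u ∣ S) - f(v ∣ S - v)`. -/
theorem IsSubmodular.exchange_le (hf : IsSubmodular f) {S : Finset β} {u v : β}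
    (hv : v ∉ S → u ≠ v → marginal f v S = 0) :
    marginal f u S - marginal f v (S.erase v) ≤ f ((insert u S).erase v) - f S := by
  -- For `u = v ∈ S` the new set is `S - u`, not `S`, since the insertion comes before the removal;
  -- the inequality is then an equality.
  by_cases huv : u = v
  · subst huv
    by_cases hu : u ∈ S
    · rw [marginal_of_mem hu, marginal, Finset.insert_erase hu, Finset.insert_eq_of_mem hu]
      linarith
    · rw [Finset.erase_eq_of_notMem hu, Finset.erase_insert hu]
      linarith
  · by_cases hvS : v ∈ S
    · have h := hf ((insert u S).erase v) S
      have h1 : (insert u S).erase v ∪ S = insert u S := by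
        ext x; by_cases hx : x = v <;> simp [hx, hvS]
      rw [h1] at h
      by_cases hu : u ∈ S
      · rw [marginal_of_mem hu, Finset.insert_eq_of_mem hu, marginal, Finset.insert_erase hvS]
        linarith
      · have h2 : (insert u S).erase v ∩ S = S.erase v := by
          ext x; by_cases hx : x = u
          · simp [hx, hu]
          · simp [hx]
        rw [h2] at h
        simp only [marginal, Finset.insert_erase hvS]
        linarith
    · have hvu : v ∉ insert u S := by simp [hvS, Ne.symm huv]
      rw [Finset.erase_eq_of_notMem hvS, hv hvS huv, Finset.erase_eq_of_notMem hvu, marginal]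
      linarith

/-- If a random set contains every element of `s` with probability at most `p`, then the expected
value of its intersection with `s` is at least `(1 - p) f(∅)`. -/
theorem IsSubmodular.le_expect_inter (hf : IsSubmodular f) (hf0 : ∀ S, 0 ≤ f S)
    {D : SetDist β} (hD : D.IsProb) {p : ℝ} (hp0 : 0 ≤ p) {s : Finset β}
    (hp : ∀ u ∈ s, D.prob (fun S => u ∈ S) ≤ p) :
    (1 - p) * f ∅ ≤ D.expect (fun S => f (S ∩ s)) := by
  -- Elements are added in order of decreasing probability. Using the induction hypothesis with `c =
  -- Pr[a ∈ S]`, the term `c f(s)` and the new contribution `c f(a ∣ s)` combine to `c f(s + a)`.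
  -- The claim is the case `c = 0`.
  suffices key : ∀ c, 0 ≤ c → c ≤ p → (∀ u ∈ s, c ≤ D.prob (fun S => u ∈ S)) →
      (1 - p) * f ∅ + c * f s ≤ D.expect (fun S => f (S ∩ s)) by
    simpa using key 0 le_rfl hp0 fun u _ => SetDist.prob_nonneg hD.nonneg _
  induction s using Finset.induction_on_min_value (fun u => D.prob (fun S => u ∈ S)) with
  | empty =>
    intro c _ hcp _
    simp only [Finset.inter_empty, hD.expect_const]
    nlinarith [hf0 ∅]
  | insert a s ha hmin ih =>
    intro c hc _ hcs
    have h1 := ih (fun u hu => hp u (Finset.mem_insert_of_mem hu)) _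
      (SetDist.prob_nonneg hD.nonneg _) (hp a (Finset.mem_insert_self _ _)) hmin
    have h2 : D.expect (fun S => f (S ∩ s) + marginal f a s * if a ∈ S then 1 else 0) ≤
        D.expect (fun S => f (S ∩ insert a s)) := by
      refine SetDist.expect_mono hD.nonneg fun S _ => ?_
      by_cases haS : a ∈ S
      · have := hf.marginal_anti (u := a) (Finset.inter_subset_right (s₁ := S) (s₂ := s)) ha
        rw [Finset.inter_insert_of_mem haS]
        simp only [haS, if_true, mul_one]
        unfold marginal at this ⊢
        linarith
      · rw [Finset.inter_insert_of_notMem haS]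
        simp [haS]
    rw [SetDist.expect_add, SetDist.expect_const_mul] at h2
    have h3 := mul_le_mul_of_nonneg_right (hcs a (Finset.mem_insert_self _ _))
      (hf0 (insert a s))
    unfold SetDist.prob at h1 h3
    unfold marginal at h2
    linarith

end Submodular

/-! ### Numerical estimates -/

section Numeric

/-- The exponent is the expansion of `-log (1 - x)` to second order, with `x ^ 3` dominating the
tail. The quadratic bound on `exp` leaves the slack `x ^ 3 * (1 / 2 - 3 / 2 * x)`, hence the range
`x ≤ 1 / 3`. -/
theorem Real.exp_neg_le_one_sub {x : ℝ} (h0 : 0 ≤ x) (h1 : x ≤ 1 / 3) :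
    Real.exp (-(x + x ^ 2 / 2 + x ^ 3)) ≤ 1 - x := by
  have h := Real.quadratic_le_exp_of_nonneg (x := x + x ^ 2 / 2 + x ^ 3) (by positivity)
  rw [Real.exp_neg, inv_le_comm₀ (Real.exp_pos _) (by linarith)]
  refine le_trans ?_ h
  rw [inv_le_iff_one_le_mul₀ (by linarith)]
  have hy : x ^ 2 + x ^ 3 ≤ (x + x ^ 2 / 2 + x ^ 3) ^ 2 := by
    have : (x + x ^ 2 / 2 + x ^ 3) ^ 2 - (x ^ 2 + x ^ 3) =
      x ^ 4 / 4 + x ^ 6 + 2 * x ^ 4 + x ^ 5 := by ring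
    have : 0 ≤ x ^ 4 / 4 + x ^ 6 + 2 * x ^ 4 + x ^ 5 := by positivity
    linarith
  have h2 : 1 ≤ (1 + (x + x ^ 2 / 2 + x ^ 3) + (x ^ 2 + x ^ 3) / 2) * (1 - x) := by
    have : (1 + (x + x ^ 2 / 2 + x ^ 3) + (x ^ 2 + x ^ 3) / 2) * (1 - x) =
      1 + x ^ 3 * (1 / 2 - 3 / 2 * x) := by ring
    have : 0 ≤ x ^ 3 * (1 / 2 - 3 / 2 * x) := mul_nonneg (by positivity) (by linarith)
    linarith
  nlinarith

/-- With `x = 2 / k ≤ 1 / 3`, the power `(1 - x) ^ k` is at least `exp (-2 - x - 2 * x ^ 2)`.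
Dividing by `1 - x ≤ exp (-x)` cancels the first-order error, so that only `O(x ^ 2)` is lost; the
factor `1 + x` is merely bounded below by `1`. -/
theorem Real.exp_neg_two_sub_le_one_sub_two_div_pow_mul {k : ℕ} (hk : 6 ≤ k) :
    Real.exp (-2) - 8 / (k : ℝ) ^ 2 ≤ (1 - 2 / (k : ℝ)) ^ (k - 1) * (1 + 2 / (k : ℝ)) := by
  have hk' : (6 : ℝ) ≤ k := by exact_mod_cast hk
  obtain ⟨x, hx⟩ : ∃ x : ℝ, x = 2 / (k : ℝ) := ⟨_, rfl⟩
  have hkx : (k : ℝ) * x = 2 := by rw [hx]; field_simp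
  have hx0 : 0 < x := by rw [hx]; positivity
  have hx1 : x ≤ 1 / 3 := by rw [hx, div_le_div_iff₀] <;> linarith
  have h8 : 8 / (k : ℝ) ^ 2 = 2 * x ^ 2 := by rw [hx]; ring
  rw [h8, ← hx]
  have h1 : Real.exp (-2 - x - 2 * x ^ 2) ≤ (1 - x) ^ k := by
    calc Real.exp (-2 - x - 2 * x ^ 2) = Real.exp (-(x + x ^ 2 / 2 + x ^ 3)) ^ k := by
          rw [← Real.exp_nat_mul]
          congr 1
          linear_combination (1 + x / 2 + x ^ 2) * hkx
      _ ≤ _ := pow_le_pow_left₀ (Real.exp_pos _).le (Real.exp_neg_le_one_sub hx0.le hx1) k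
  have h2 : (1 - x) ^ k = (1 - x) ^ (k - 1) * (1 - x) := by
    rw [← pow_succ]; congr 1; omega
  have h3 : 1 - x ≤ Real.exp (-x) := by linarith [Real.add_one_le_exp (-x)]
  have h4 : Real.exp (-2 - x - 2 * x ^ 2) =
      Real.exp (-x) * (Real.exp (-2) * Real.exp (-(2 * x ^ 2))) := by
    rw [← Real.exp_add, ← Real.exp_add]; congr 1; ring
  have h5 : Real.exp (-2) * Real.exp (-(2 * x ^ 2)) ≤ (1 - x) ^ (k - 1) := by
    rw [h4, h2] at h1
    have h6 : Real.exp (-2) * Real.exp (-(2 * x ^ 2)) * (1 - x) ≤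
        Real.exp (-x) * (Real.exp (-2) * Real.exp (-(2 * x ^ 2))) := by
      rw [mul_comm]
      exact mul_le_mul_of_nonneg_right h3 (by positivity)
    exact le_of_mul_le_mul_right (h6.trans h1) (by linarith)
  have h6 : 1 - 2 * x ^ 2 ≤ Real.exp (-(2 * x ^ 2)) := by
    linarith [Real.add_one_le_exp (-(2 * x ^ 2))]
  have h7 : Real.exp (-2) ≤ 1 := Real.exp_le_one_iff.2 (by norm_num)
  have h9 : 0 ≤ (1 - x) ^ (k - 1) := pow_nonneg (by linarith) _
  nlinarith [Real.exp_pos (-2), mul_nonneg h9 hx0.le,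
    mul_le_mul_of_nonneg_left h6 (Real.exp_pos (-2)).le, sq_nonneg x]

/-- With `q = 1 - 2/k`, the constant part of the forcing term sums to `(1 - q ^ i) / 4`; the part `q
^ i` is resonant and sums to `i (1 - q) / 4 * q ^ (i - 1)`. At `i = k` one has `k (1 - q) = 2`. -/
theorem Real.le_of_recurrence_two_div {k : ℕ} (hk : 2 ≤ k) {a : ℕ → ℝ} {c : ℝ} (h0 : 0 ≤ a 0)
    (h : ∀ i < k, (1 - 2 / (k : ℝ)) * a i +
      1 / (k : ℝ) * ((1 + (1 - 2 / (k : ℝ)) ^ i) / 2 * c) ≤ a (i + 1)) :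
    (1 + (1 - 2 / (k : ℝ)) ^ (k - 1) * (1 + 2 / (k : ℝ))) / 4 * c ≤ a k := by
  have hk' : (2 : ℝ) ≤ k := by exact_mod_cast hk
  obtain ⟨q, hq⟩ : ∃ q : ℝ, q = 1 - 2 / (k : ℝ) := ⟨_, rfl⟩
  have hq0 : 0 ≤ q := by
    rw [hq, sub_nonneg, div_le_one (by linarith)]
    exact hk'
  have hkq : 1 / (k : ℝ) = (1 - q) / 2 := by rw [hq]; ring
  have h2 : 1 + 2 / (k : ℝ) = 2 - q := by rw [hq]; ring
  rw [h2]
  rw [← hq] at h ⊢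
  rw [hkq] at h
  -- The induction starts at `1` because the step rewrites `q ^ i` as `q * q ^ (i - 1)`, with
  -- truncated subtraction.
  have key : ∀ i ≤ k, 1 ≤ i → ((1 - q ^ i) / 4 + i * (1 - q) / 4 * q ^ (i - 1)) * c ≤ a i := by
    intro i hi h1
    induction i, h1 using Nat.le_induction with
    | base =>
      have := h 0 (by omega)
      simp only [pow_zero, zero_add] at this
      norm_num
      nlinarith [mul_nonneg hq0 h0]
    | succ i h1 ih =>
      have h3 := mul_le_mul_of_nonneg_left (ih (by omega)) hq0
      have h4 := h i (by omega)
      have h5 : q ^ i = q * q ^ (i - 1) := by rw [← pow_succ']; congr 1; omega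
      refine le_trans (le_of_eq ?_) ((add_le_add_left h3 _).trans h4)
      rw [Nat.add_sub_cancel, pow_succ, h5]
      push_cast
      ring
  have h6 := key k le_rfl (by omega)
  refine le_trans (le_of_eq ?_) h6
  have h7 : (k : ℝ) * (1 - q) = 2 := by rw [hq]; field_simp; ring
  have h8 : q ^ k = q * q ^ (k - 1) := by rw [← pow_succ']; congr 1; omega
  rw [h7, h8]
  ring

end Numeric

/-! ### The matroid with dummy elements -/

section ExtendedMatroid

variable {α : Type*} {M : Matroid α} {k : ℕ}

theorem ExtIndep.subset {S T : Finset (DExt α k)} (hT : ExtIndep M k T) (h : S ⊆ T) :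
    ExtIndep M k S :=
  ⟨hT.1.subset (Finset.coe_subset.2 (Finset.toLeft_subset_toLeft h)),
    (Finset.card_le_card h).trans hT.2⟩

/-- There are enough dummies to pad any independent set to size `k`; hence all bases have exactly
`k` elements. -/
theorem ExtIndep.exists_isExtBase {S : Finset (DExt α k)} (hS : ExtIndep M k S) :
    ∃ T, S ⊆ T ∧ T.toLeft = S.toLeft ∧ ExtIndep M k T ∧ T.card = k := by
  have hc := S.card_toLeft_add_card_toRight
  have hk := hS.2
  obtain ⟨R, hR, -, hRc⟩ := Finset.exists_subsuperset_card_eq (Finset.subset_univ S.toRight)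
    (n := k - S.toLeft.card) (by omega) (by rw [Finset.card_univ, Fintype.card_fin]; omega)
  have hcard : (S.toLeft.disjSum R).card = k := by rw [Finset.card_disjSum]; omega
  refine ⟨S.toLeft.disjSum R, ?_, by simp, ⟨?_, hcard.le⟩, hcard⟩
  · rw [Finset.subset_disjSum]
    exact ⟨subset_rfl, hR⟩
  · rw [Finset.toLeft_disjSum]
    exact hS.1

theorem isExtBase_iff {S : Finset (DExt α k)} :
    IsExtBase M k S ↔ ExtIndep M k S ∧ S.card = k := by
  constructor
  · intro h
    obtain ⟨T, hST, -, hT, hc⟩ := h.prop.exists_isExtBase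
    have : S = T := subset_antisymm hST (h.2 hT hST)
    exact ⟨h.prop, this ▸ hc⟩
  · rintro ⟨h, hc⟩
    refine ⟨h, fun T hT hST => ?_⟩
    exact (Finset.eq_of_subset_of_card_le hST (hT.2.trans hc.ge)).ge

variable [DecidableEq α]

/-- A dummy of `T` outside `S` can always be added. If there is none, the larger size of `T` comes
from its non-dummy part, and augmentation in `M` applies. -/
theorem ExtIndep.augment {S T : Finset (DExt α k)} (hS : ExtIndep M k S) (hT : ExtIndep M k T)
    (h : S.card < T.card) : ∃ e ∈ T, e ∉ S ∧ ExtIndep M k (insert e S) := by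
  have hcard : ∀ e, (insert e S).card ≤ k := fun e =>
    (Finset.card_insert_le e S).trans (h.trans_le hT.2)
  by_cases hR : T.toRight ⊆ S.toRight
  · have h1 := Finset.card_le_card hR
    have h2 := S.card_toLeft_add_card_toRight
    have h3 := T.card_toLeft_add_card_toRight
    obtain ⟨e, he, hi⟩ := hS.1.augment hT.1 (by
      rw [Set.encard_coe_eq_coe_finsetCard, Set.encard_coe_eq_coe_finsetCard]
      exact_mod_cast (by omega : S.toLeft.card < T.toLeft.card))
    simp only [Set.mem_sdiff, Finset.mem_coe, Finset.mem_toLeft] at he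
    refine ⟨.inl e, he.1, he.2, ?_, hcard _⟩
    rw [Finset.toLeft_insert_inl, Finset.coe_insert]
    exact hi
  · obtain ⟨b, hb, hbS⟩ := Finset.not_subset.1 hR
    rw [Finset.mem_toRight] at hb hbS
    refine ⟨.inr b, hb, hbS, ?_, hcard _⟩
    rw [Finset.toLeft_insert_inr]
    exact hS.1

theorem ExtIndep.exists_subset_union {S T : Finset (DExt α k)} (hS : ExtIndep M k S)
    (hT : ExtIndep M k T) (hc : T.card = k) :
    ∃ J, S ⊆ J ∧ J ⊆ S ∪ T ∧ ExtIndep M k J ∧ J.card = k := by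
  obtain ⟨m, hm⟩ : ∃ m, m = k - S.card := ⟨_, rfl⟩
  induction m generalizing S with
  | zero => exact ⟨S, subset_rfl, Finset.subset_union_left, hS, by have := hS.2; omega⟩
  | succ m ih =>
    obtain ⟨e, heT, heS, hi⟩ := hS.augment hT (by omega)
    obtain ⟨J, h1, h2, h3⟩ := ih hi (by rw [Finset.card_insert_of_notMem heS]; omega)
    refine ⟨J, (Finset.subset_insert _ _).trans h1, h2.trans ?_, h3⟩
    rw [Finset.insert_union, Finset.insert_subset_iff]
    exact ⟨Finset.mem_union_right _ heT, subset_rfl⟩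

/-- Bijective basis exchange. -/
theorem exists_exchange_injOn {B T : Finset (DExt α k)} (hB : IsExtBase M k B)
    (hT : IsExtBase M k T) : ∃ g : DExt α k → DExt α k, Set.MapsTo g B T ∧ Set.InjOn g B ∧
      (∀ u ∈ B ∩ T, g u = u) ∧ ∀ u ∈ B, ExtIndep M k ((insert u T).erase (g u)) := by
  classical
  rw [isExtBase_iff] at hB hT
  -- The admissible partners of `u`; the second condition forces the identity on `B ∩ T`. Hall's
  -- theorem picks distinct partners.
  let t : B → Finset (DExt α k) := fun u =>
    T.filter fun v => ExtIndep M k ((insert u.1 T).erase v) ∧ (u.1 ∈ T → v = u.1)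
  have hall : ∀ s : Finset B, s.card ≤ (s.biUnion t).card := by
    intro s
    by_contra! hlt
    obtain ⟨X, hX⟩ : ∃ X, X = s.map (Function.Embedding.subtype _) := ⟨_, rfl⟩
    obtain ⟨N, hN⟩ : ∃ N, N = s.biUnion t := ⟨_, rfl⟩
    have hXc : X.card = s.card := by rw [hX, Finset.card_map]
    have hXB : X ⊆ B := by
      intro u hu
      rw [hX, Finset.mem_map] at hu
      obtain ⟨v, -, rfl⟩ := hu
      exact v.2
    have hNT : N ⊆ T := by
      rw [hN, Finset.biUnion_subset]
      exact fun u _ => Finset.filter_subset _ _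
    have htN : ∀ u ∈ X, ∀ v ∈ T, ExtIndep M k ((insert u T).erase v) → (u ∈ T → v = u) →
        v ∈ N := by
      intro u hu v hv h1 h2
      rw [hX, Finset.mem_map] at hu
      obtain ⟨w, hw, rfl⟩ := hu
      rw [hN, Finset.mem_biUnion]
      exact ⟨w, hw, Finset.mem_filter.2 ⟨hv, h1, h2⟩⟩
    have hXN : X ∩ T ⊆ N := by
      intro u hu
      rw [Finset.mem_inter] at hu
      refine htN u hu.1 u hu.2 (hT.1.subset ?_) fun _ => rfl
      rw [Finset.insert_eq_of_mem hu.2]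
      exact Finset.erase_subset _ _
    -- If `X` violates Hall's condition, `N ∪ (B ∩ T)` can be augmented by some `u ∈ X \ T` and
    -- completed inside `T + u` to a base `J = T + u - v`. Then `v` is a partner of `u`, so `v ∈ N ⊆
    -- J`, which is absurd.
    have hlt' : (N ∪ (B ∩ T)).card < (X ∪ (B ∩ T)).card := by
      have h1 := Finset.card_sdiff_add_card N (B ∩ T)
      have h2 := Finset.card_sdiff_add_card X (B ∩ T)
      have h3 := Finset.card_sdiff_add_card_inter N (B ∩ T)
      have h4 := Finset.card_sdiff_add_card_inter X (B ∩ T)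
      have h5 : (X ∩ (B ∩ T)).card ≤ (N ∩ (B ∩ T)).card := by
        refine Finset.card_le_card fun u hu => ?_
        simp only [Finset.mem_inter] at hu ⊢
        exact ⟨hXN (Finset.mem_inter.2 ⟨hu.1, hu.2.2⟩), hu.2⟩
      rw [← hN, ← hXc] at hlt
      omega
    obtain ⟨u, hu, huN, hi⟩ := (hT.1.subset (Finset.union_subset hNT
      Finset.inter_subset_right)).augment (hB.1.subset (Finset.union_subset hXB
      Finset.inter_subset_left)) hlt'
    simp only [Finset.mem_union, Finset.mem_inter, not_or, not_and] at hu huN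
    have huX : u ∈ X := hu.elim id fun h => absurd h.2 (huN.2 h.1)
    have huT : u ∉ T := huN.2 (hXB huX)
    obtain ⟨J, hJ1, hJ2, hJ3, hJ4⟩ := hi.exists_subset_union hT.1 hT.2
    rw [Finset.insert_subset_iff] at hJ1
    have hJT : J ⊆ insert u T := by
      refine hJ2.trans (Finset.union_subset (Finset.insert_subset_insert _ ?_)
        (Finset.subset_insert _ _))
      exact Finset.union_subset hNT Finset.inter_subset_right
    have hTJ : ¬ T ⊆ J := fun h => by
      have := Finset.card_le_card (Finset.insert_subset hJ1.1 h)
      rw [Finset.card_insert_of_notMem huT] at this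
      omega
    obtain ⟨v, hvT, hvJ⟩ := Finset.not_subset.1 hTJ
    have hJe : J = (insert u T).erase v := by
      refine Finset.eq_of_subset_of_card_le (fun x hx => Finset.mem_erase.2
        ⟨fun h => hvJ (h ▸ hx), hJT hx⟩) ?_
      rw [Finset.card_erase_of_mem (Finset.mem_insert_of_mem hvT),
        Finset.card_insert_of_notMem huT]
      omega
    exact hvJ (hJ1.2 (Finset.mem_union_left _
      (htN u huX v hvT (hJe ▸ hJ3) fun h => absurd h huT)))
  obtain ⟨g, hg, hgt⟩ := (Finset.all_card_le_biUnion_card_iff_exists_injective t).1 hall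
  have hgt' : ∀ u : B, g u ∈ T ∧ ExtIndep M k ((insert u.1 T).erase (g u)) ∧
      (u.1 ∈ T → g u = u.1) := fun u => Finset.mem_filter.1 (hgt u)
  refine ⟨fun u => if h : u ∈ B then g ⟨u, h⟩ else u, ?_, ?_, ?_, ?_⟩
  · intro u hu
    simp only [Finset.mem_coe] at hu ⊢
    rw [dif_pos hu]
    exact (hgt' _).1
  · intro u hu v hv huv
    simp only [Finset.mem_coe] at hu hv
    simp only [dif_pos hu, dif_pos hv] at huv
    exact congrArg Subtype.val (hg huv)
  · intro u hu
    rw [Finset.mem_inter] at hu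
    simp only [dif_pos hu.1]
    exact (hgt' _).2.2 hu.2
  · intro u hu
    simp only [dif_pos hu]
    exact (hgt' ⟨u, hu⟩).2.1

end ExtendedMatroid

/-! ### Existence of the combinatorial choices; exchange mappings -/

namespace DerandomizedGreedy

variable {α : Type*} {M : Matroid α} {k : ℕ}

theorem exists_isInitialSet (M : Matroid α) (k : ℕ) : ∃ S, IsInitialSet M k S := by
  have h0 : (∅ : Finset (DExt α k)).toLeft = ∅ := by ext; simp
  obtain ⟨T, -, h1, h2⟩ := ExtIndep.exists_isExtBase (M := M) (k := k) (S := ∅)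
    (by simp [ExtIndep, h0])
  exact ⟨T, isExtBase_iff.2 h2, h1.trans h0⟩

variable [DecidableEq α]

theorem exists_isMaxBase [Fintype α] (M : Matroid α) (h : Finset (DExt α k) → ℝ)
    (D : SetDist (DExt α k)) : ∃ B, IsMaxBase M h D B := by
  classical
  obtain ⟨T, hT⟩ := exists_isInitialSet M k
  obtain ⟨B, hB, hmax⟩ := Finset.exists_max_image
    ((Finset.univ : Finset (Finset (DExt α k))).filter (IsExtBase M k))
    (fun B => ∑ u ∈ B, D.expect (fun S => marginal h u S)) ⟨T, by simpa using hT.1⟩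
  simp only [Finset.mem_filter, Finset.mem_univ, true_and] at hB hmax
  exact ⟨B, hB, hmax⟩

theorem exists_isExchange {B S : Finset (DExt α k)} (hB : IsExtBase M k B)
    (hS : ExtIndep M k S) : ∃ g, IsExchange M B S g := by
  obtain ⟨T, h1, h2, h3⟩ := hS.exists_isExtBase
  have hT := isExtBase_iff.2 h3
  obtain ⟨g, hg⟩ := exists_exchange_injOn hB hT
  exact ⟨g, T, hT, h1, h2, hg⟩

theorem exists_isBest [Fintype α] (h : Finset (DExt α k) → ℝ) {D : SetDist (DExt α k)}
    (hD : D.supp.Nonempty) : ∃ S, IsBest h D S :=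
  Finset.exists_max_image D.supp h hD

namespace IsExchange

variable {B S : Finset (DExt α k)} {g : DExt α k → DExt α k}

theorem extIndep (h : IsExchange M B S g) {u : DExt α k} (hu : u ∈ B) :
    ExtIndep M k ((insert u S).erase (g u)) := by
  obtain ⟨T, -, hST, -, -, -, -, hi⟩ := h
  exact (hi u hu).subset (Finset.erase_subset_erase _ (Finset.insert_subset_insert _ hST))

/-- An element that is exchanged is in `S` or is a dummy element. -/
theorem apply_mem_or (h : IsExchange M B S g) {u : DExt α k} (hu : u ∈ B) :
    g u ∈ S ∨ ∃ b, g u = .inr b := by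
  obtain ⟨T, -, hST, hl, hm, -⟩ := h
  have h1 : g u ∈ T := hm hu
  rcases hgu : g u with a | b
  · left
    rw [hgu, ← Finset.mem_toLeft, hl, Finset.mem_toLeft] at h1
    exact h1
  · exact .inr ⟨b, rfl⟩

/-- The exchange mapping is a bijection onto a base that contains `S`. -/
theorem exists_image_eq (h : IsExchange M B S g) (hB : IsExtBase M k B) :
    ∃ T, S ⊆ T ∧ T.toLeft = S.toLeft ∧ B.image g = T ∧ Set.InjOn g B := by
  obtain ⟨T, hT, hST, hl, hm, hinj, -⟩ := h
  refine ⟨T, hST, hl, Finset.eq_of_subset_of_card_le ?_ ?_, hinj⟩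
  · intro v hv
    obtain ⟨u, hu, rfl⟩ := Finset.mem_image.1 hv
    exact hm hu
  · rw [Finset.card_image_of_injOn hinj, (isExtBase_iff.1 hB).2, (isExtBase_iff.1 hT).2]

theorem card_filter_eq_one (h : IsExchange M B S g) (hB : IsExtBase M k B) {u : DExt α k}
    (hu : u ∈ S) : (B.filter fun v => g v = u).card = 1 := by
  obtain ⟨T, hST, -, him, hinj⟩ := h.exists_image_eq hB
  have h1 := hST hu
  rw [← him, Finset.mem_image] at h1
  obtain ⟨v, hv, rfl⟩ := h1
  rw [Finset.card_eq_one]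
  refine ⟨v, Finset.eq_singleton_iff_unique_mem.2 ⟨by simp [hv], fun w hw => ?_⟩⟩
  rw [Finset.mem_filter] at hw
  exact hinj hw.1 hv hw.2

end IsExchange

end DerandomizedGreedy

/-! ### The linear program: feasibility, extreme points and their sparsity -/

namespace DerandomizedGreedy

variable {α : Type*} {k : ℕ}

/-- The linear functional `x ↦ ∑ u ∈ B, E_{S ∼ D} [x(u,S) m(u,S)]`. -/
def pairing (D : SetDist (DExt α k)) (B : Finset (DExt α k))
    (m : DExt α k → Finset (DExt α k) → ℝ) :
    (DExt α k → Finset (DExt α k) → ℝ) →ₗ[ℝ] ℝ where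
  toFun x := ∑ u ∈ B, D.expect fun S => x u S * m u S
  map_add' x y := by
    simp only [Pi.add_apply, add_mul, SetDist.expect_add, Finset.sum_add_distrib]
  map_smul' c x := by
    simp only [Pi.smul_apply, smul_eq_mul, mul_assoc, SetDist.expect_const_mul, Finset.mul_sum,
      RingHom.id_apply]

theorem pairing_apply (D : SetDist (DExt α k)) (B : Finset (DExt α k))
    (m x : DExt α k → Finset (DExt α k) → ℝ) :
    pairing D B m x = ∑ u ∈ B, D.expect fun S => x u S * m u S := rfl

theorem pairing_add_left (D : SetDist (DExt α k)) (B : Finset (DExt α k))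
    (m m' x : DExt α k → Finset (DExt α k) → ℝ) :
    pairing D B (fun u S => m u S + m' u S) x = pairing D B m x + pairing D B m' x := by
  simp only [pairing_apply, mul_add, SetDist.expect_add, Finset.sum_add_distrib]

theorem pairing_sub_left (D : SetDist (DExt α k)) (B : Finset (DExt α k))
    (m m' x : DExt α k → Finset (DExt α k) → ℝ) :
    pairing D B (fun u S => m u S - m' u S) x = pairing D B m x - pairing D B m' x := by
  simp only [pairing_apply, mul_sub, SetDist.expect_sub, Finset.sum_sub_distrib]

variable [DecidableEq α]

theorem continuous_pairing (D : SetDist (DExt α k)) (B : Finset (DExt α k))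
    (m : DExt α k → Finset (DExt α k) → ℝ) : Continuous (pairing D B m) := by
  have : (pairing D B m : (DExt α k → Finset (DExt α k) → ℝ) → ℝ) = fun x =>
      ∑ u ∈ B, ∑ S ∈ D.supp, D.prob (fun T => T = S) * (x u S * m u S) := by
    ext x
    simp only [pairing_apply, SetDist.expect_eq_sum_supp]
  rw [this]
  fun_prop

theorem pairing_mono {D : SetDist (DExt α k)} (hD : ∀ q ∈ D, 0 ≤ q.1) {B : Finset (DExt α k)}
    {m m' x : DExt α k → Finset (DExt α k) → ℝ} (hx : ∀ u ∈ B, ∀ S ∈ D.supp, 0 ≤ x u S)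
    (h : ∀ u ∈ B, ∀ S ∈ D.supp, m u S ≤ m' u S) : pairing D B m x ≤ pairing D B m' x :=
  Finset.sum_le_sum fun u hu => SetDist.expect_mono hD fun S hS =>
    mul_le_mul_of_nonneg_left (h u hu S hS) (hx u hu S hS)

theorem pairing_congr {D : SetDist (DExt α k)} {B : Finset (DExt α k)}
    {m m' x : DExt α k → Finset (DExt α k) → ℝ} (h : ∀ u ∈ B, ∀ S ∈ D.supp, m u S = m' u S) :
    pairing D B m x = pairing D B m' x :=
  Finset.sum_congr rfl fun u hu => SetDist.expect_congr fun S hS => by rw [h u hu S hS]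

theorem pairing_of_sum_eq_one {D : SetDist (DExt α k)} {B : Finset (DExt α k)}
    {x : DExt α k → Finset (DExt α k) → ℝ} (hx : ∀ S ∈ D.supp, ∑ u ∈ B, x u S = 1)
    (φ : Finset (DExt α k) → ℝ) : pairing D B (fun _ S => φ S) x = D.expect φ := by
  rw [pairing_apply, ← SetDist.expect_finset_sum]
  exact SetDist.expect_congr fun S hS => by rw [← Finset.sum_mul, hx S hS, one_mul]

/-- The constraint `add` of the linear program is a bound on `pairing` with this function. -/
def addIndicator (u v : DExt α k) (S : Finset (DExt α k)) : ℝ :=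
  if v = u ∧ u ∉ S then 1 else 0

/-- The constraint `kick` of the linear program is a bound on `pairing` with this function. -/
def kickIndicator (g : Finset (DExt α k) → DExt α k → DExt α k) (u v : DExt α k)
    (S : Finset (DExt α k)) : ℝ :=
  if g S v = u ∧ u ∈ S then 1 else 0

theorem pairing_addIndicator (D : SetDist (DExt α k)) {B : Finset (DExt α k)}
    (x : DExt α k → Finset (DExt α k) → ℝ) {u : DExt α k} (hu : u ∈ B) :
    pairing D B (addIndicator u) x = D.expect (fun S => x u S * if u ∉ S then 1 else 0) := by
  rw [pairing_apply, Finset.sum_eq_single u]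
  · simp [addIndicator]
  · intro v _ hv
    simp [addIndicator, hv, SetDist.expect]
  · exact fun h => absurd hu h

theorem pairing_addIndicator_of_notMem (D : SetDist (DExt α k)) {B : Finset (DExt α k)}
    (x : DExt α k → Finset (DExt α k) → ℝ) {u : DExt α k} (hu : u ∉ B) :
    pairing D B (addIndicator u) x = 0 :=
  Finset.sum_eq_zero fun v hv => by
    have : v ≠ u := fun h => hu (h ▸ hv)
    simp [addIndicator, this, SetDist.expect]

theorem pairing_kickIndicator (D : SetDist (DExt α k)) (B : Finset (DExt α k))
    (g : Finset (DExt α k) → DExt α k → DExt α k) (x : DExt α k → Finset (DExt α k) → ℝ)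
    (u : DExt α k) : pairing D B (kickIndicator g u) x =
      D.expect (fun S => (∑ v ∈ B with g S v = u, x v S) * if u ∈ S then 1 else 0) := by
  rw [pairing_apply, ← SetDist.expect_finset_sum]
  refine SetDist.expect_congr fun S _ => ?_
  rw [Finset.sum_filter, Finset.sum_mul]
  refine Finset.sum_congr rfl fun v _ => ?_
  by_cases h1 : g S v = u <;> by_cases h2 : u ∈ S <;> simp [kickIndicator, h1, h2]

theorem isFeasible_iff {h : Finset (DExt α k) → ℝ} {D : SetDist (DExt α k)}
    {B : Finset (DExt α k)} {g : Finset (DExt α k) → DExt α k → DExt α k}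
    {x : DExt α k → Finset (DExt α k) → ℝ} :
    IsFeasible h D B g x ↔
      1 / (k : ℝ) * ∑ u ∈ B, D.expect (fun S => marginal h u S) ≤ pairing D B (marginal h) x ∧
      pairing D B (fun u S => marginal h (g S u) (S.erase (g S u))) x ≤
        1 / (k : ℝ) * ∑ u ∈ B, D.expect (fun S => marginal h (g S u) (S.erase (g S u))) ∧
      (∀ u ∈ B, pairing D B (addIndicator u) x ≤ 1 / (k : ℝ) * D.prob (fun S => u ∉ S)) ∧
      (∀ u, 1 / (k : ℝ) * D.prob (fun S => u ∈ S) ≤ pairing D B (kickIndicator g u) x) ∧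
      (∀ S ∈ D.supp, ∑ u ∈ B, x u S = 1) ∧
      (∀ u ∈ B, ∀ S ∈ D.supp, 0 ≤ x u S) ∧
      ∀ u S, ¬ (u ∈ B ∧ S ∈ D.supp) → x u S = 0 := by
  simp only [pairing_kickIndicator]
  constructor
  · rintro ⟨h1, h2, h3, h4⟩
    exact ⟨h1, h2, fun u hu => by rw [pairing_addIndicator D x hu]; exact h3 u hu, h4, ‹_›, ‹_›, ‹_›⟩
  · rintro ⟨h1, h2, h3, h4, h5, h6, h7⟩
    exact ⟨h1, h2, fun u hu => by rw [← pairing_addIndicator D x hu]; exact h3 u hu, h4, h5, h6, h7⟩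

section Feasible

variable {M : Matroid α} {h : Finset (DExt α k) → ℝ} {D : SetDist (DExt α k)}
  {B : Finset (DExt α k)} {g : Finset (DExt α k) → DExt α k → DExt α k}

/-- The uniform choice `x(u,S) = 1 / k` is feasible. -/
theorem isFeasible_uniform (hk : 1 ≤ k) (hB : IsExtBase M k B)
    (hg : ∀ S ∈ D.supp, IsExchange M B S (g S)) :
    IsFeasible h D B g (fun u S => if u ∈ B ∧ S ∈ D.supp then 1 / (k : ℝ) else 0) := by
  have hk0 : (k : ℝ) ≠ 0 := by positivity
  -- At the uniform point every functional is `1 / k` times its unweighted sum, so all the averaged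
  -- constraints hold with equality.
  have hunif : ∀ m, pairing D B m (fun u S => if u ∈ B ∧ S ∈ D.supp then 1 / (k : ℝ) else 0) =
      1 / (k : ℝ) * ∑ u ∈ B, D.expect (m u) := by
    intro m
    rw [pairing_apply, Finset.mul_sum]
    refine Finset.sum_congr rfl fun u hu => ?_
    rw [← SetDist.expect_const_mul]
    exact SetDist.expect_congr fun S hS => by simp [hu, hS]
  rw [isFeasible_iff]
  simp only [hunif]
  refine ⟨le_rfl, le_rfl, fun u hu => ?_, fun u => ?_, fun S hS => ?_, fun u _ S _ => ?_,
    fun u S hu => if_neg hu⟩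
  · refine le_of_eq ?_
    rw [Finset.sum_eq_single u, SetDist.prob]
    · exact congrArg _ (SetDist.expect_congr fun S _ => by simp [addIndicator])
    · intro v _ hv
      simp [addIndicator, hv, SetDist.expect]
    · exact fun h => absurd hu h
  · refine le_of_eq ?_
    rw [← SetDist.expect_finset_sum, SetDist.prob]
    congr 1
    refine SetDist.expect_congr fun S hS => ?_
    by_cases hu : u ∈ S
    · simp [kickIndicator, hu, (hg S hS).card_filter_eq_one hB hu]
    · simp [kickIndicator, hu]
  · rw [Finset.sum_congr rfl fun u hu => if_pos ⟨hu, hS⟩, Finset.sum_const,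
      (isExtBase_iff.1 hB).2, nsmul_eq_mul]
    field_simp
  · positivity

theorem isClosed_setOf_isFeasible : IsClosed {x | IsFeasible h D B g x} := by
  have hp := continuous_pairing (k := k) D B
  simp only [isFeasible_iff, Set.ofPred_and, Set.ofPred_forall]
  refine .inter (isClosed_le continuous_const (hp _)) <|
    .inter (isClosed_le (hp _) continuous_const) <|
    .inter (isClosed_iInter fun u => isClosed_iInter fun _ => isClosed_le (hp _) continuous_const) <|
    .inter (isClosed_iInter fun u => isClosed_le continuous_const (hp _)) <|
    .inter (isClosed_iInter fun S => isClosed_iInter fun _ =>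
      isClosed_eq (by fun_prop) continuous_const) <|
    .inter (isClosed_iInter fun u => isClosed_iInter fun _ => isClosed_iInter fun S =>
      isClosed_iInter fun _ => isClosed_le continuous_const (by fun_prop)) ?_
  exact isClosed_iInter fun u => isClosed_iInter fun S => isClosed_iInter fun _ =>
    isClosed_eq (by fun_prop) continuous_const

theorem IsFeasible.mem_Icc {x : DExt α k → Finset (DExt α k) → ℝ} (hx : IsFeasible h D B g x)
    (u : DExt α k) (S : Finset (DExt α k)) : x u S ∈ Set.Icc (0 : ℝ) 1 := by
  by_cases hu : u ∈ B ∧ S ∈ D.supp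
  · refine ⟨hx.nonneg u hu.1 S hu.2, ?_⟩
    rw [← hx.sum_eq_one S hu.2]
    exact Finset.single_le_sum (fun v hv => hx.nonneg v hv S hu.2) hu.1
  · rw [hx.eq_zero u S hu]
    simp

theorem isCompact_setOf_isFeasible : IsCompact {x | IsFeasible h D B g x} := by
  refine IsCompact.of_isClosed_subset (isCompact_univ_pi fun _ => isCompact_univ_pi fun _ =>
    isCompact_Icc (a := (0 : ℝ)) (b := 1)) isClosed_setOf_isFeasible fun x hx => ?_
  exact fun u _ S _ => hx.mem_Icc u S

/-- The region lies in a product of unit intervals, the irrelevant coordinates being pinned to `0`;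
a non-empty compact set has an extreme point by Krein–Milman. -/
theorem exists_isExtremeSolution (hk : 1 ≤ k) (hB : IsExtBase M k B)
    (hg : ∀ S ∈ D.supp, IsExchange M B S (g S)) : ∃ x, IsExtremeSolution h D B g x :=
  isCompact_setOf_isFeasible.extremePoints_nonempty ⟨_, isFeasible_uniform hk hB hg⟩

/-- The linear forms of all the constraints of the linear program, except for non-negativity. -/
def constraintMap (h : Finset (DExt α k) → ℝ) (D : SetDist (DExt α k)) (B : Finset (DExt α k))
    (g : Finset (DExt α k) → DExt α k → DExt α k) :
    (DExt α k → Finset (DExt α k) → ℝ) →ₗ[ℝ]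
      ℝ × ℝ × (DExt α k → ℝ) × (DExt α k → ℝ) × (D.supp → ℝ) :=
  (pairing D B (marginal h)).prod <|
    (pairing D B fun u S => marginal h (g S u) (S.erase (g S u))).prod <|
    (LinearMap.pi fun u => pairing D B (addIndicator u)).prod <|
    (LinearMap.pi fun u => pairing D B (kickIndicator g u)).prod <|
    LinearMap.pi fun S => ∑ u ∈ B, LinearMap.proj S.1 ∘ₗ LinearMap.proj u

/-- Moving in the kernel of the constraint forms changes neither side of any other constraint, so
only non-negativity can fail. -/
theorem IsFeasible.add_of_constraintMap_eq_zero {x y : DExt α k → Finset (DExt α k) → ℝ}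
    (hx : IsFeasible h D B g x) (hy : constraintMap h D B g y = 0)
    (hy0 : ∀ u S, x u S = 0 → y u S = 0) (hxy : ∀ u S, 0 ≤ x u S + y u S) :
    IsFeasible h D B g (x + y) := by
  have y1 : pairing D B (marginal h) y = 0 := congrArg Prod.fst hy
  have y2 : pairing D B (fun u S => marginal h (g S u) (S.erase (g S u))) y = 0 :=
    congrArg (fun z => z.2.1) hy
  have y3 : ∀ u, pairing D B (addIndicator u) y = 0 :=
    congrFun (congrArg (fun z => z.2.2.1) hy)
  have y4 : ∀ u, pairing D B (kickIndicator g u) y = 0 :=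
    congrFun (congrArg (fun z => z.2.2.2.1) hy)
  have y5 : ∀ S : D.supp, ∑ u ∈ B, y u S = 0 := fun S => by
    have := congrFun (congrArg (fun z => z.2.2.2.2) hy) S
    simpa [constraintMap] using this
  obtain ⟨h1, h2, h3, h4, h5, h6, h7⟩ := isFeasible_iff.1 hx
  rw [isFeasible_iff]
  simp only [map_add, y1, y2, y3, y4, add_zero, Pi.add_apply, Finset.sum_add_distrib]
  refine ⟨h1, h2, h3, h4, fun S hS => ?_, fun u _ S _ => hxy u S, fun u S hu => ?_⟩
  · rw [h5 S hS, y5 ⟨S, hS⟩, add_zero]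
  · rw [h7 u S hu, hy0 u S (h7 u S hu), add_zero]

/-- An extreme point solution has at most as many positive coordinates as there are constraints. -/
theorem IsExtremeSolution.card_pos_le [Fintype α] {x : DExt α k → Finset (DExt α k) → ℝ}
    (hx : IsExtremeSolution h D B g x) :
    ((B ×ˢ D.supp).filter fun q => 0 < x q.1 q.2).card ≤
      2 + 2 * (Fintype.card α + 2 * k) + D.supp.card := by
  classical
  obtain ⟨P, hP⟩ : ∃ P, P = (B ×ˢ D.supp).filter fun q => 0 < x q.1 q.2 := ⟨_, rfl⟩
  rw [← hP]
  have hxf : IsFeasible h D B g x := hx.1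
  have hpos : ∀ p : P, 0 < x p.1.1 p.1.2 := fun p => by
    obtain ⟨p, hp⟩ := p
    rw [hP, Finset.mem_filter] at hp
    exact hp.2
  have hzero : ∀ u S, (u, S) ∉ P → x u S ≤ 0 := fun u S hu => by
    by_contra! hlt
    refine hu ?_
    rw [hP, Finset.mem_filter, Finset.mem_product]
    refine ⟨?_, hlt⟩
    by_contra hn
    exact hlt.ne' (hxf.eq_zero u S hn)
  -- Extension by zero from the positive coordinates of `x`. With more such coordinates than
  -- constraint forms, some `c ≠ 0` gives a direction `J c` in the kernel.
  let J : (P → ℝ) →ₗ[ℝ] (DExt α k → Finset (DExt α k) → ℝ) :=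
    LinearMap.pi fun u => LinearMap.pi fun S =>
      if hu : (u, S) ∈ P then LinearMap.proj ⟨(u, S), hu⟩ else 0
  have hJ : ∀ c (p : P), J c p.1.1 p.1.2 = c p := fun c p => by simp [J]
  have hJ0 : ∀ c u S, (u, S) ∉ P → J c u S = 0 := fun c u S hu => by simp [J, hu]
  by_contra! hlt
  obtain ⟨c, hc, hc0⟩ := (Submodule.ne_bot_iff _).1 (LinearMap.ker_ne_bot_of_finrank_lt
    (f := constraintMap h D B g ∘ₗ J) (by
      simp only [Module.finrank_prod, Module.finrank_self, Module.finrank_pi, Fintype.card_sum,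
        Fintype.card_fin, Fintype.card_coe]
      omega))
  rw [LinearMap.mem_ker, LinearMap.comp_apply] at hc
  obtain ⟨ε, hε0, hε⟩ : ∃ ε : ℝ, 0 < ε ∧ ∀ p : P, ε * |c p| < x p.1.1 p.1.2 := by
    have : ∀ᶠ ε : ℝ in nhdsWithin 0 (Set.Ioi 0), ∀ p : P, ε * |c p| < x p.1.1 p.1.2 := by
      refine Filter.eventually_all.2 fun p => nhdsWithin_le_nhds ?_
      have ht : Filter.Tendsto (fun ε : ℝ => ε * |c p|) (nhds 0) (nhds (0 * |c p|)) :=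
        (continuous_id.mul continuous_const).tendsto 0
      rw [zero_mul] at ht
      exact ht.eventually_lt_const (hpos p)
    obtain ⟨ε, h1, h2⟩ := (this.and self_mem_nhdsWithin).exists
    exact ⟨ε, h2, h1⟩
  have hfeas : ∀ δ : ℝ, |δ| = ε → IsFeasible h D B g (x + δ • J c) := by
    intro δ hδ
    refine hxf.add_of_constraintMap_eq_zero (by rw [map_smul, hc, smul_zero]) ?_ ?_
    · intro u S h0
      have : (u, S) ∉ P := fun hu => (hpos ⟨_, hu⟩).ne' h0
      simp [hJ0 c u S this]
    · intro u S
      by_cases hu : (u, S) ∈ P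
      · have h1 := hε ⟨_, hu⟩
        have h2 := hJ c ⟨_, hu⟩
        have h3 := neg_abs_le (δ * c ⟨_, hu⟩)
        rw [abs_mul, hδ] at h3
        simp only [Pi.smul_apply, smul_eq_mul]
        simp only at h1 h2
        rw [h2]
        linarith
      · simpa [hJ0 c u S hu] using (hxf.mem_Icc u S).1
  -- `x` is the midpoint of two feasible points `x ± ε • J c`; extremality makes them coincide with
  -- `x`, contradicting `c ≠ 0`.
  have hmem := hx.2 (hfeas ε (abs_of_pos hε0)) (hfeas (-ε) (by rw [abs_neg, abs_of_pos hε0]))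
    ⟨1 / 2, 1 / 2, by norm_num, by norm_num, by norm_num, by
      ext u S
      simp only [Pi.add_apply, Pi.smul_apply, smul_eq_mul]
      ring⟩
  refine hc0 (funext fun p => ?_)
  have h1 := congrFun (congrFun hmem p.1.1) p.1.2
  simp only [Pi.add_apply, Pi.smul_apply, smul_eq_mul, hJ c p, add_eq_left,
    mul_eq_zero, hε0.ne', false_or] at h1
  exact h1

end Feasible

end DerandomizedGreedy

/-! ### The extended function and the updated distribution -/

namespace DerandomizedGreedy

variable {α : Type*} {k : ℕ}

/-- The extension of a set function to the dummy elements, `f'(S) = f(S ∖ D)`. -/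
def extend (k : ℕ) (f : Finset α → ℝ) (S : Finset (DExt α k)) : ℝ := f S.toLeft

theorem extend_map_inl_union [DecidableEq α] (f : Finset α → ℝ) (O : Finset α)
    (S : Finset (DExt α k)) :
    extend k f (O.map .inl ∪ S) = f (O ∪ S.toLeft) := by
  rw [extend, Finset.toLeft_union]
  congr 2
  ext a
  simp

variable [DecidableEq α] {f : Finset α → ℝ}

theorem isSubmodular_extend (hf : IsSubmodular f) : IsSubmodular (extend k f) := by
  intro S T
  simp only [extend, Finset.toLeft_union, Finset.toLeft_inter]
  exact hf _ _

theorem marginal_extend_inr (f : Finset α → ℝ) (b : Fin (2 * k)) (S : Finset (DExt α k)) :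
    marginal (extend k f) (.inr b) S = 0 := by
  simp [marginal, extend]

section NewDist

variable {D : SetDist (DExt α k)} {B : Finset (DExt α k)}
  {g : Finset (DExt α k) → DExt α k → DExt α k} {x : DExt α k → Finset (DExt α k) → ℝ}

/-- Expectations after an iteration become linear functionals of `x`, which the constraints can
bound. The pairs with `x u S = 0`, dropped from `newDist`, contribute nothing. -/
theorem expect_newDist (hx : ∀ u ∈ B, ∀ S ∈ D.supp, 0 ≤ x u S) (φ : Finset (DExt α k) → ℝ) :
    (newDist D B g x).expect φ =
      pairing D B (fun u S => φ ((insert u S).erase (g S u))) x := by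
  rw [newDist, SetDist.expect, Multiset.map_map]
  change ∑ q ∈ (B ×ˢ D.supp).filter fun q => 0 < x q.1 q.2,
    x q.1 q.2 * D.prob (fun S => S = q.2) * φ ((insert q.1 q.2).erase (g q.2 q.1)) = _
  rw [Finset.sum_filter_of_ne, Finset.sum_product, pairing_apply]
  · refine Finset.sum_congr rfl fun u _ => ?_
    rw [SetDist.expect_eq_sum_supp]
    exact Finset.sum_congr rfl fun S _ => by ring
  · intro q hq hne
    rw [Finset.mem_product] at hq
    refine lt_of_le_of_ne (hx q.1 hq.1 q.2 hq.2) fun h0 => hne ?_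
    rw [← h0]
    ring

theorem isProb_newDist (hD : D.IsProb) (hx : ∀ u ∈ B, ∀ S ∈ D.supp, 0 ≤ x u S)
    (hx1 : ∀ S ∈ D.supp, ∑ u ∈ B, x u S = 1) : (newDist D B g x).IsProb := by
  constructor
  · intro q hq
    rw [newDist, Multiset.mem_map] at hq
    obtain ⟨p, hp, rfl⟩ := hq
    rw [Finset.mem_val, Finset.mem_filter] at hp
    exact mul_nonneg hp.2.le (SetDist.prob_nonneg hD.nonneg _)
  · rw [expect_newDist hx, pairing_of_sum_eq_one hx1 fun _ => 1, hD.expect_one]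

theorem exists_of_mem_supp_newDist {S : Finset (DExt α k)} (hS : S ∈ (newDist D B g x).supp) :
    ∃ u ∈ B, ∃ T ∈ D.supp, S = (insert u T).erase (g T u) := by
  obtain ⟨q, hq, rfl⟩ := SetDist.mem_supp.1 hS
  rw [newDist, Multiset.mem_map] at hq
  obtain ⟨p, hp, rfl⟩ := hq
  rw [Finset.mem_val, Finset.mem_filter, Finset.mem_product] at hp
  exact ⟨p.1, hp.1.1, p.2, hp.1.2, rfl⟩

theorem card_newDist : Multiset.card (newDist D B g x) =
    ((B ×ˢ D.supp).filter fun q => 0 < x q.1 q.2).card := by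
  rw [newDist, Multiset.card_map, Finset.card_val]

end NewDist

/-! ### Analysis of one iteration -/

section Step

variable {M : Matroid α} {D : SetDist (DExt α k)} {B : Finset (DExt α k)}
  {g : Finset (DExt α k) → DExt α k → DExt α k} {x : DExt α k → Finset (DExt α k) → ℝ}

/-- If an element belongs to the random set with probability `p`, then after one iteration it
belongs to it with probability at most `(1 - 2/k) p + 1/k`. -/
theorem prob_mem_newDist_le {h : Finset (DExt α k) → ℝ} (hD : D.IsProb)
    (hx : IsFeasible h D B g x) (u : DExt α k) :
    (newDist D B g x).prob (fun S => u ∈ S) ≤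
      (1 - 2 / (k : ℝ)) * D.prob (fun S => u ∈ S) + 1 / (k : ℝ) := by
  have h1 : (newDist D B g x).prob (fun S => u ∈ S) ≤ pairing D B
      (fun v S => ((if u ∈ S then 1 else 0) - kickIndicator g u v S) + addIndicator u v S) x := by
    rw [SetDist.prob, expect_newDist hx.nonneg]
    refine pairing_mono hD.nonneg hx.nonneg fun v _ S _ => ?_
    have hmem : u ∈ (insert v S).erase (g S v) ↔ ¬ g S v = u ∧ (v = u ∨ u ∈ S) := by
      rw [Finset.mem_erase, Finset.mem_insert, ne_comm, eq_comm (a := u)]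
    simp only [hmem, kickIndicator, addIndicator]
    split_ifs <;> first | norm_num; done | (exfalso; tauto)
  rw [pairing_add_left, pairing_sub_left, pairing_of_sum_eq_one hx.sum_eq_one] at h1
  have hkick := (isFeasible_iff.1 hx).2.2.2.1 u
  -- The program bounds additions only for `u ∈ B`; an element outside `B` is never added.
  have hadd : pairing D B (addIndicator u) x ≤ 1 / (k : ℝ) * (1 - D.prob (fun S => u ∈ S)) := by
    by_cases hu : u ∈ B
    · rw [← hD.prob_not]
      exact (isFeasible_iff.1 hx).2.2.1 u hu
    · rw [pairing_addIndicator_of_notMem D x hu]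
      have := hD.prob_le_one fun S => u ∈ S
      have : 0 ≤ 1 - D.prob (fun S => u ∈ S) := by linarith
      positivity
  have h2 : D.expect (fun S => if u ∈ S then 1 else 0) = D.prob fun S => u ∈ S := rfl
  rw [h2] at h1
  have h3 : (1 - 2 / (k : ℝ)) * D.prob (fun S => u ∈ S) + 1 / (k : ℝ) =
      D.prob (fun S => u ∈ S) - 1 / (k : ℝ) * D.prob (fun S => u ∈ S) +
        1 / (k : ℝ) * (1 - D.prob (fun S => u ∈ S)) := by ring
  rw [h3]
  linarith

/-- The images under `e` run once through a base `T ⊇ S` whose elements outside `S` are dummies with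
zero marginal. What remains is the sum over `S`, at most `f(S) - f(∅)`. -/
theorem sum_marginal_exchange_le (hf : IsSubmodular f) (hf0 : ∀ S, 0 ≤ f S)
    (hB : IsExtBase M k B) {S : Finset (DExt α k)} {e : DExt α k → DExt α k}
    (he : IsExchange M B S e) :
    ∑ u ∈ B, marginal (extend k f) (e u) (S.erase (e u)) ≤ extend k f S := by
  obtain ⟨T, hST, hl, him, hinj⟩ := he.exists_image_eq hB
  have h1 := Finset.sum_image (f := fun v => marginal (extend k f) v (S.erase v)) hinj
  rw [← h1, him, ← Finset.sum_subset hST]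
  · have h2 := (isSubmodular_extend (k := k) hf).sum_marginal_erase_le S
    have h3 : 0 ≤ extend k f ∅ := hf0 _
    linarith
  · intro v hv hvS
    rcases v with a | b
    · rw [← Finset.mem_toLeft, hl, Finset.mem_toLeft] at hv
      exact absurd hv hvS
    · exact marginal_extend_inr f b _

/-- `O` padded with dummies is a base competing with `B`, and its dummies have zero marginals. -/
theorem le_sum_expect_marginal (hf : IsSubmodular f) (hD : D.IsProb)
    (hB : IsMaxBase M (extend k f) D B) {O : Finset α} (hO : M.Indep (O : Set α))
    (hOk : O.card ≤ k) :
    D.expect (fun S => f (O ∪ S.toLeft)) - D.expect (extend k f) ≤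
      ∑ u ∈ B, D.expect (fun S => marginal (extend k f) u S) := by
  have hO' : ExtIndep M k (O.map .inl : Finset (DExt α k)) := by
    constructor
    · have : (O.map .inl : Finset (DExt α k)).toLeft = O := by ext a; simp
      rwa [this]
    · rwa [Finset.card_map]
  obtain ⟨T, hOT, hl, hT⟩ := hO'.exists_isExtBase
  refine le_trans ?_ (hB.2 T (isExtBase_iff.2 hT))
  rw [← SetDist.expect_finset_sum, ← SetDist.expect_sub]
  refine SetDist.expect_mono hD.nonneg fun S _ => ?_
  rw [← Finset.sum_subset hOT, ← extend_map_inl_union f]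
  · exact (isSubmodular_extend hf).sub_le_sum_marginal _ _
  · intro v hv hvO
    rcases v with a | b
    · rw [← Finset.mem_toLeft, hl, Finset.mem_toLeft] at hv
      exact absurd hv hvO
    · exact marginal_extend_inr f b _

/-- The expected gain of one iteration. -/
theorem le_expect_newDist (hf : IsSubmodular f) (hf0 : ∀ S, 0 ≤ f S) (hD : D.IsProb)
    (hB : IsMaxBase M (extend k f) D B) (hg : ∀ S ∈ D.supp, IsExchange M B S (g S))
    (hx : IsFeasible (extend k f) D B g x) {O : Finset α} (hO : M.Indep (O : Set α))
    (hOk : O.card ≤ k) :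
    (1 - 2 / (k : ℝ)) * D.expect (extend k f) +
      1 / (k : ℝ) * D.expect (fun S => f (O ∪ S.toLeft)) ≤
      (newDist D B g x).expect (extend k f) := by
  have h1 : pairing D B (fun u S => extend k f S + (marginal (extend k f) u S -
      marginal (extend k f) (g S u) (S.erase (g S u)))) x ≤
      (newDist D B g x).expect (extend k f) := by
    rw [expect_newDist hx.nonneg]
    refine pairing_mono hD.nonneg hx.nonneg fun u hu S hS => ?_
    have := (isSubmodular_extend (k := k) hf).exchange_le (S := S) (u := u) (v := g S u) (by
      intro h1 _
      obtain ⟨b, hb⟩ := ((hg S hS).apply_mem_or hu).resolve_left h1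
      rw [hb]
      exact marginal_extend_inr f b S)
    linarith
  rw [pairing_add_left, pairing_of_sum_eq_one hx.sum_eq_one, pairing_sub_left] at h1
  -- The term `-2/k` collects `E f(S) / k` twice: once from the gain `f(O ∪ S) - f(S)`, once from
  -- the removal loss.
  obtain ⟨hgain, hloss, -⟩ := isFeasible_iff.1 hx
  have h2 := le_sum_expect_marginal hf hD hB hO hOk
  have h3 : ∑ u ∈ B, D.expect (fun S => marginal (extend k f) (g S u) (S.erase (g S u))) ≤
      D.expect (extend k f) := by
    rw [← SetDist.expect_finset_sum]
    exact SetDist.expect_mono hD.nonneg fun S hS => sum_marginal_exchange_le hf hf0 hB.1 (hg S hS)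
  have hk : 0 ≤ 1 / (k : ℝ) := by positivity
  have h4 := mul_le_mul_of_nonneg_left h2 hk
  have h5 := mul_le_mul_of_nonneg_left h3 hk
  have h6 : 2 / (k : ℝ) = 2 * (1 / (k : ℝ)) := by ring
  rw [h6]
  change _ ≤ pairing D B (fun u S => marginal (extend k f) u S) x at hgain
  linarith

/-- The sampling bound for `S ↦ f'(O ∪ S)`, with `s` the set of all non-dummy elements: dummies may
have large probability, but do not affect the value. -/
theorem le_expect_union (hf : IsSubmodular f) (hf0 : ∀ S, 0 ≤ f S) (hD : D.IsProb) [Fintype α]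
    {p : ℝ} (hp0 : 0 ≤ p) (hp : ∀ a : α, D.prob (fun S => .inl a ∈ S) ≤ p) (O : Finset α) :
    (1 - p) * f O ≤ D.expect (fun S => f (O ∪ S.toLeft)) := by
  have h1 := ((isSubmodular_extend (k := k) hf).union_right (O.map .inl)).le_expect_inter
    (fun _ => hf0 _) hD hp0 (s := Finset.univ.map .inl) (by simpa using hp)
  simp only [extend_map_inl_union] at h1
  have h2 : O ∪ (∅ : Finset (DExt α k)).toLeft = O := by ext; simp
  rw [h2] at h1
  refine h1.trans_eq (SetDist.expect_congr fun S _ => ?_)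
  congr 2
  ext a
  simp

end Step

/-! ### Queried tables agree with the extended function where they are used -/

section Queries

theorem eval_queryTable (f : Finset α → ℝ) (L : List (Finset (DExt α k))) {T : Finset (DExt α k)}
    (hT : T ∈ L) : (queryTable L).eval f T = extend k f T := by
  induction L with
  | nil => simp at hT
  | cons T' L ih =>
    simp only [queryTable, QueryAlg.eval, QueryAlg.eval_bind]
    by_cases h : T = T'
    · subst h; simp [extend]
    · rw [Function.update_of_ne h]
      exact ih ((List.mem_cons.1 hT).resolve_left h)

theorem numQueries_queryTable (f : Finset α → ℝ) (L : List (Finset (DExt α k))) :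
    (queryTable L).numQueries f = L.length := by
  induction L with
  | nil => rfl
  | cons T L ih => simp [queryTable, QueryAlg.numQueries, ih]

theorem eval_finalQueries (f : Finset α → ℝ) {D : SetDist (DExt α k)} {S : Finset (DExt α k)}
    (hS : S ∈ D.supp) : (finalQueries D).eval f S = extend k f S :=
  eval_queryTable f _ (Finset.mem_toList.2 hS)

theorem numQueries_finalQueries (f : Finset α → ℝ) (D : SetDist (DExt α k)) :
    (finalQueries D).numQueries f = D.supp.card := by
  rw [finalQueries, numQueries_queryTable, Finset.length_toList]

variable [Fintype α]

theorem eval_stepQueries (f : Finset α → ℝ) {D : SetDist (DExt α k)} {S : Finset (DExt α k)}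
    (hS : S ∈ querySets D) : (stepQueries D).eval f S = extend k f S :=
  eval_queryTable f _ (Finset.mem_toList.2 hS)

theorem numQueries_stepQueries_le (f : Finset α → ℝ) (D : SetDist (DExt α k)) :
    (stepQueries D).numQueries f ≤ D.supp.card * (1 + 2 * (Fintype.card α + 2 * k)) := by
  rw [stepQueries, numQueries_queryTable, Finset.length_toList]
  refine Finset.card_biUnion_le_card_mul _ _ _ fun S _ => ?_
  have h1 : (Finset.univ : Finset (DExt α k)).card = Fintype.card α + 2 * k := by
    rw [Finset.card_univ, Fintype.card_sum, Fintype.card_fin]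
  have h2 := Finset.card_image_le (s := Finset.univ) (f := fun u : DExt α k => insert u S)
  have h3 := Finset.card_image_le (s := Finset.univ) (f := fun u : DExt α k => S.erase u)
  refine (Finset.card_union_le _ _).trans ?_
  have h4 := Finset.card_union_le {S} (Finset.univ.image fun u : DExt α k => insert u S)
  rw [Finset.card_singleton] at h4
  omega

theorem marginal_stepQueries (f : Finset α → ℝ) {D : SetDist (DExt α k)} {S : Finset (DExt α k)}
    (hS : S ∈ D.supp) (u : DExt α k) :
    marginal ((stepQueries D).eval f) u S = marginal (extend k f) u S := by
  rw [marginal, marginal, eval_stepQueries, eval_stepQueries] <;>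
  · rw [querySets, Finset.mem_biUnion]
    exact ⟨S, hS, by simp⟩

/-- An exchanged dummy may lie outside `S`; then `S - u = S` and the value needed is that of `S +
u`, which is also queried. -/
theorem marginal_erase_stepQueries (f : Finset α → ℝ) {D : SetDist (DExt α k)}
    {S : Finset (DExt α k)} (hS : S ∈ D.supp) (u : DExt α k) :
    marginal ((stepQueries D).eval f) u (S.erase u) = marginal (extend k f) u (S.erase u) := by
  by_cases hu : u ∈ S
  · rw [marginal, marginal, Finset.insert_erase hu, eval_stepQueries, eval_stepQueries] <;>
    · rw [querySets, Finset.mem_biUnion]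
      exact ⟨S, hS, by simp⟩
  · rw [Finset.erase_eq_of_notMem hu, marginal_stepQueries f hS]

theorem isMaxBase_stepQueries_iff {M : Matroid α} {D : SetDist (DExt α k)}
    {B : Finset (DExt α k)} : IsMaxBase M ((stepQueries D).eval f) D B ↔
      IsMaxBase M (extend k f) D B := by
  have h : ∀ u, D.expect (fun S => marginal ((stepQueries D).eval f) u S) =
      D.expect (fun S => marginal (extend k f) u S) := fun u =>
    SetDist.expect_congr fun S hS => marginal_stepQueries f hS u
  simp only [IsMaxBase, h]

theorem isFeasible_stepQueries_iff {D : SetDist (DExt α k)} {B : Finset (DExt α k)}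
    {g : Finset (DExt α k) → DExt α k → DExt α k} {x : DExt α k → Finset (DExt α k) → ℝ} :
    IsFeasible ((stepQueries D).eval f) D B g x ↔ IsFeasible (extend k f) D B g x := by
  have h1 : ∀ u, D.expect (fun S => marginal ((stepQueries D).eval f) u S) =
      D.expect (fun S => marginal (extend k f) u S) := fun u =>
    SetDist.expect_congr fun S hS => marginal_stepQueries f hS u
  have h2 : ∀ u,
      D.expect (fun S => marginal ((stepQueries D).eval f) (g S u) (S.erase (g S u))) =
      D.expect (fun S => marginal (extend k f) (g S u) (S.erase (g S u))) := fun u =>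
    SetDist.expect_congr fun S hS => marginal_erase_stepQueries f hS _
  have h3 : pairing D B (marginal ((stepQueries D).eval f)) x =
      pairing D B (marginal (extend k f)) x :=
    pairing_congr fun u _ S hS => marginal_stepQueries f hS u
  have h4 : pairing D B
      (fun u S => marginal ((stepQueries D).eval f) (g S u) (S.erase (g S u))) x =
      pairing D B (fun u S => marginal (extend k f) (g S u) (S.erase (g S u))) x :=
    pairing_congr fun u _ S hS => marginal_erase_stepQueries f hS _
  simp only [isFeasible_iff, h1, h2, h3, h4]

end Queries

/-! ### Invariants, query count and value over all iterations -/

section Iterations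

variable [Fintype α] {M : Matroid α} {r : Choices α k}

/-- The table `t` is arbitrary: existence of the choices depends only on the support being
independent, not on the values of `f`. -/
theorem Choices.Valid.stepCorrect (hr : r.Valid M) (hk : 1 ≤ k) (i : ℕ) {D : SetDist (DExt α k)}
    (hD : ∀ S ∈ D.supp, ExtIndep M k S) (t : Finset (DExt α k) → ℝ) :
    r.StepCorrect M i D t := by
  have hB := hr.base i D t (exists_isMaxBase M t D)
  have hg : ∀ S ∈ D.supp, IsExchange M (r.base i D t) S (r.exch i D t S) := fun S hS =>
    hr.exch i D t S hS (exists_isExchange hB.1 (hD S hS))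
  exact ⟨hB, hg, hr.point i D t (exists_isExtremeSolution hk hB.1 hg)⟩

theorem eval_iterations_succ (r : Choices α k) (f : Finset α → ℝ) (i : ℕ) :
    (iterations r (i + 1)).eval f =
      newDist ((iterations r i).eval f)
        (r.base i ((iterations r i).eval f) ((stepQueries ((iterations r i).eval f)).eval f))
        (r.exch i ((iterations r i).eval f) ((stepQueries ((iterations r i).eval f)).eval f))
        (r.point i ((iterations r i).eval f) ((stepQueries ((iterations r i).eval f)).eval f)) := by
  simp only [iterations, QueryAlg.eval_bind, QueryAlg.eval_ret]

theorem Choices.Valid.isProb_and_extIndep (hr : r.Valid M) (hk : 1 ≤ k) (f : Finset α → ℝ)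
    (i : ℕ) : ((iterations r i).eval f).IsProb ∧
      ∀ S ∈ ((iterations r i).eval f).supp, ExtIndep M k S := by
  induction i with
  | zero =>
    refine ⟨SetDist.isProb_singleton _, fun S hS => ?_⟩
    have : S = r.init := by simpa [iterations, SetDist.supp] using hS
    rw [this]
    exact (hr.init (exists_isInitialSet M k)).1.prop
  | succ i ih =>
    obtain ⟨-, hg, hx⟩ := hr.stepCorrect hk i ih.2
      ((stepQueries ((iterations r i).eval f)).eval f)
    rw [eval_iterations_succ]
    refine ⟨isProb_newDist ih.1 hx.1.nonneg hx.1.sum_eq_one, fun S hS => ?_⟩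
    obtain ⟨u, hu, T, hT, rfl⟩ := exists_of_mem_supp_newDist hS
    exact (hg T hT).extIndep hu

theorem Choices.Valid.runCorrect (hr : r.Valid M) (hk : 1 ≤ k) (f : Finset α → ℝ) :
    RunCorrect r M f :=
  ⟨hr.init (exists_isInitialSet M k),
    fun i _ => hr.stepCorrect hk i (hr.isProb_and_extIndep hk f i).2 _,
    hr.best _ _ (exists_isBest _ (hr.isProb_and_extIndep hk f k).1.supp_nonempty)⟩

/-- Sparsity makes the growth additive: only the normalization constraints scale with the support,
one for each set. -/
theorem Choices.Valid.card_iterations_le (hr : r.Valid M) (hk : 1 ≤ k) (f : Finset α → ℝ)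
    (i : ℕ) : Multiset.card ((iterations r i).eval f) ≤
      1 + i * (2 + 2 * (Fintype.card α + 2 * k)) := by
  induction i with
  | zero => simp [iterations]
  | succ i ih =>
    obtain ⟨-, -, hx⟩ := hr.stepCorrect hk i (hr.isProb_and_extIndep hk f i).2
      ((stepQueries ((iterations r i).eval f)).eval f)
    rw [eval_iterations_succ, card_newDist]
    have h1 := hx.card_pos_le
    have h2 := SetDist.card_supp_le ((iterations r i).eval f)
    rw [add_one_mul]
    omega

theorem Choices.Valid.numQueries_iterations_le (hr : r.Valid M) (hk : 1 ≤ k)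
    (f : Finset α → ℝ) (i : ℕ) : (iterations r i).numQueries f ≤
      i * ((1 + i * (2 + 2 * (Fintype.card α + 2 * k))) *
        (1 + 2 * (Fintype.card α + 2 * k))) := by
  induction i with
  | zero => simp [iterations]
  | succ i ih =>
    have h1 := numQueries_stepQueries_le f ((iterations r i).eval f)
    have h2 := (SetDist.card_supp_le _).trans (hr.card_iterations_le hk f i)
    have h3 : (iterations r (i + 1)).numQueries f = (iterations r i).numQueries f +
        (stepQueries ((iterations r i).eval f)).numQueries f := by
      simp [iterations]
    rw [h3]
    generalize Fintype.card α + 2 * k = N at *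
    have h4 : 1 + i * (2 + 2 * N) ≤ 1 + (i + 1) * (2 + 2 * N) := by gcongr; omega
    calc _ ≤ i * ((1 + i * (2 + 2 * N)) * (1 + 2 * N)) + (1 + i * (2 + 2 * N)) * (1 + 2 * N) :=
          add_le_add ih (h1.trans (Nat.mul_le_mul_right _ h2))
      _ = (i + 1) * ((1 + i * (2 + 2 * N)) * (1 + 2 * N)) := by ring
      _ ≤ _ := by gcongr

theorem Choices.Valid.numQueries_algorithm_le (hr : r.Valid M) (hk : 1 ≤ k)
    (hkn : k ≤ Fintype.card α) (f : Finset α → ℝ) :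
    (algorithm r).numQueries f ≤ 100 * Fintype.card α ^ 2 * k ^ 2 := by
  have h1 := hr.numQueries_iterations_le hk f k
  have h2 := (SetDist.card_supp_le _).trans (hr.card_iterations_le hk f k)
  have h3 : (algorithm r).numQueries f = (iterations r k).numQueries f +
      ((iterations r k).eval f).supp.card := by
    simp [algorithm, numQueries_finalQueries]
  rw [h3]
  generalize Fintype.card α = n at *
  have h4 : 1 ≤ k * n := Nat.mul_pos hk (hk.trans hkn)
  -- Lower-order terms are absorbed using `1 ≤ k ≤ n`. The total is `63 + 9 = 72` times `n ^ 2 * k ^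
  -- 2`.
  have h5 : 1 + k * (2 + 2 * (n + 2 * k)) ≤ 9 * (k * n) := by
    have h6 : k * (2 + 2 * (n + 2 * k)) ≤ k * (8 * n) := Nat.mul_le_mul_left _ (by omega)
    have h7 : k * (8 * n) = 8 * (k * n) := by ring
    omega
  have h6 : 1 + 2 * (n + 2 * k) ≤ 7 * n := by omega
  calc _ ≤ k * (9 * (k * n) * (7 * n)) + 9 * (k * n) * 1 :=
        add_le_add (h1.trans (Nat.mul_le_mul_left _ (Nat.mul_le_mul h5 h6)))
          (by rw [mul_one]; exact h2.trans h5)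
    _ ≤ k * (9 * (k * n) * (7 * n)) + 9 * (k * n) * (k * n) := by gcongr
    _ = 72 * (n ^ 2 * k ^ 2) := by ring
    _ ≤ 100 * (n ^ 2 * k ^ 2) := by gcongr; norm_num
    _ = _ := by ring

/-- The map `p ↦ (1 - 2/k) p + 1/k` contracts towards its fixed point `1/2`, and the iteration
starts at `p = 0` since the initial set is all dummies. For `k ≥ 2` the map is monotone. -/
theorem Choices.Valid.prob_mem_iterations_le (hr : r.Valid M) (hk : 2 ≤ k) (f : Finset α → ℝ)
    (a : α) (i : ℕ) : ((iterations r i).eval f).prob (fun S => .inl a ∈ S) ≤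
      (1 - (1 - 2 / (k : ℝ)) ^ i) / 2 := by
  have hk' : (2 : ℝ) ≤ k := by exact_mod_cast hk
  have hq : 0 ≤ 1 - 2 / (k : ℝ) := by
    rw [sub_nonneg, div_le_one (by linarith)]
    exact hk'
  induction i with
  | zero =>
    have h0 : (.inl a : DExt α k) ∉ r.init := by
      rw [← Finset.mem_toLeft, (hr.init (exists_isInitialSet M k)).2]
      simp
    simp [iterations, SetDist.prob, SetDist.expect, h0]
  | succ i ih =>
    obtain ⟨hD, hi⟩ := hr.isProb_and_extIndep (one_le_two.trans hk) f i
    obtain ⟨-, -, hx⟩ := hr.stepCorrect (one_le_two.trans hk) i hi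
      ((stepQueries ((iterations r i).eval f)).eval f)
    rw [eval_iterations_succ]
    refine (prob_mem_newDist_le hD hx.1 _).trans
      ((add_le_add_left (mul_le_mul_of_nonneg_left ih hq) _).trans_eq ?_)
    rw [pow_succ]
    ring

theorem Choices.Valid.le_expect_iterations (hr : r.Valid M) (hk : 2 ≤ k) (hf0 : ∀ S, 0 ≤ f S)
    (hf : IsSubmodular f) {O : Finset α} (hO : M.Indep (O : Set α)) (hOk : O.card ≤ k) :
    (1 + (1 - 2 / (k : ℝ)) ^ (k - 1) * (1 + 2 / (k : ℝ))) / 4 * f O ≤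
      ((iterations r k).eval f).expect (extend k f) := by
  have hk' : (2 : ℝ) ≤ k := by exact_mod_cast hk
  have hq : 0 ≤ 1 - 2 / (k : ℝ) := by
    rw [sub_nonneg, div_le_one (by linarith)]
    exact hk'
  refine Real.le_of_recurrence_two_div hk
    (a := fun i => ((iterations r i).eval f).expect (extend k f)) ?_ fun i _ => ?_
  · exact SetDist.expect_nonneg (hr.isProb_and_extIndep (one_le_two.trans hk) f 0).1.nonneg
      fun _ _ => hf0 _
  · obtain ⟨hD, hi⟩ := hr.isProb_and_extIndep (one_le_two.trans hk) f i
    obtain ⟨hB, hg, hx⟩ := hr.stepCorrect (one_le_two.trans hk) i hi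
      ((stepQueries ((iterations r i).eval f)).eval f)
    have h1 := le_expect_newDist hf hf0 hD (isMaxBase_stepQueries_iff.1 hB) hg
      (isFeasible_stepQueries_iff.1 hx.1) hO hOk
    have h2 := le_expect_union hf hf0 hD (by
      have := pow_le_one₀ (n := i) hq (sub_le_self _ (by positivity))
      linarith) (fun a => hr.prob_mem_iterations_le hk f a i) O
    simp only [eval_iterations_succ]
    refine le_trans ?_ h1
    have h3 : (1 + (1 - 2 / (k : ℝ)) ^ i) / 2 = 1 - (1 - (1 - 2 / (k : ℝ)) ^ i) / 2 := by ring
    rw [h3]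
    gcongr

theorem Choices.Valid.eval_algorithm (hr : r.Valid M) (hk : 1 ≤ k) (f : Finset α → ℝ) :
    M.Indep (((algorithm r).eval f : Finset α) : Set α) ∧
      ((iterations r k).eval f).expect (extend k f) ≤ f ((algorithm r).eval f) := by
  obtain ⟨hD, hi⟩ := hr.isProb_and_extIndep hk f k
  obtain ⟨-, -, hb, hmax⟩ := hr.runCorrect hk f
  have h1 : (algorithm r).eval f = (r.best ((iterations r k).eval f)
      ((finalQueries ((iterations r k).eval f)).eval f)).toLeft := by
    simp [algorithm]
  rw [h1]
  refine ⟨(hi _ hb).1, ?_⟩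
  rw [← hD.expect_const (f _)]
  refine SetDist.expect_mono hD.nonneg fun S hS => ?_
  have := hmax S hS
  rwa [eval_finalQueries f hS, eval_finalQueries f hb] at this

end Iterations

end DerandomizedGreedy

/-! ### The main theorem -/

theorem mainTheorem1 :
    ∃ C : ℝ, 0 < C ∧
      ∀ (α : Type*) [Fintype α] [DecidableEq α] (M : Matroid α) (k : ℕ),
        M.E = Set.univ → M.eRank = (k : ℕ∞) → 1 ≤ k →
        ∀ r : DerandomizedGreedy.Choices α k, r.Valid M →
        ∀ f : Finset α → ℝ, (∀ S, 0 ≤ f S) → IsSubmodular f →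
          DerandomizedGreedy.RunCorrect r M f ∧
          M.Indep (((DerandomizedGreedy.algorithm r).eval f : Finset α) : Set α) ∧
          (∀ O : Finset α, M.Indep (O : Set α) →
            ((1 + Real.exp (-2)) / 4 - C / (k : ℝ) ^ 2) * f O ≤
              f ((DerandomizedGreedy.algorithm r).eval f)) ∧
          ((DerandomizedGreedy.algorithm r).numQueries f : ℝ) ≤
            C * (Fintype.card α : ℝ) ^ 2 * (k : ℝ) ^ 2 := by
  refine ⟨100, by norm_num, ?_⟩
  intro α _ _ M k hE hM hk r hr f hf0 hf
  have hcard : ∀ O : Finset α, M.Indep (O : Set α) → O.card ≤ k := fun O hO => by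
    have := hO.encard_le_eRank
    rw [hM, Set.encard_coe_eq_coe_finsetCard] at this
    exact_mod_cast this
  have hkn : k ≤ Fintype.card α := by
    have := M.eRank_le_encard_ground
    rw [hM, hE, Set.encard_univ, ENat.card_eq_coe_fintype_card] at this
    exact_mod_cast this
  obtain ⟨hind, hle⟩ := hr.eval_algorithm hk f
  refine ⟨hr.runCorrect hk f, hind, fun O hO => ?_, ?_⟩
  · have hk0 : (0 : ℝ) < k := by exact_mod_cast hk
    -- For `k < 6` the constant `100` makes the approximation factor non-positive, so the bound is
    -- trivial; the exponential estimate needs `k ≥ 6`.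
    rcases lt_or_ge k 6 with h6 | h6
    · have h1 : Real.exp (-2) ≤ 1 := Real.exp_le_one_iff.2 (by norm_num)
      have h2 : 1 ≤ 100 / (k : ℝ) ^ 2 := by
        have h6' : (k : ℝ) ≤ 6 := by exact_mod_cast h6.le
        rw [one_le_div (by positivity)]
        nlinarith
      exact (mul_nonpos_of_nonpos_of_nonneg (by linarith) (hf0 O)).trans (hf0 _)
    · have h1 := hr.le_expect_iterations (by omega) hf0 hf hO (hcard O hO)
      have h2 := Real.exp_neg_two_sub_le_one_sub_two_div_pow_mul h6
      refine (mul_le_mul_of_nonneg_right ?_ (hf0 O)).trans (h1.trans hle)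
      have h3 : 100 / (k : ℝ) ^ 2 = 8 / (k : ℝ) ^ 2 / 4 + 98 / (k : ℝ) ^ 2 := by ring
      have h4 : 0 ≤ 98 / (k : ℝ) ^ 2 := by positivity
      linarith
  · exact_mod_cast hr.numQueries_algorithm_le hk hkn f
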